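/- Let $r:\mathbb Z\to\mathbb C$ be any function with $r(n)=r(1-n)$ for all $n$. Let $\phi_m$ $(m\in\mathbb Z)$ be neutral fermions, $\phi_m\phi_n+\phi_n\phi_m=(-1)^m\delta_{m,-n}$, acting on the Fock space with vacuum vectors $|0\rangle$, $\langle 0|$: $\phi_m|0\rangle=0$ for $m<0$, $\langle 0|\phi_m=0$ for $m>0$, $\langle 0|0\rangle=1$, $\langle 0|\phi_0|0\rangle=0$. For odd $m>0$ put $$H_m=\tfrac12\sum_{k\in\mathbb Z}(-1)^{k+1}\phi_k\phi_{-k-m},\qquad B_m=\tfrac12\sum_{n\in\mathbb Z}(-1)^n\phi_n\phi_{m-n}\,r(n)r(n-1)\cdots r(n-m+1),$$ and let $$\tau_r(t,t^*)=\langle 0|\exp\Big(\sum_{m=1,3,\dots}t_mH_m\Big)\exp\Big(-\sum_{m=1,3,\dots}t^*_mB_m\Big)|0\rangle .$$ For $x=(x_1,\dots,x_N)$ and $y=(y_1,\dots,y_{N^*})$ let $m\,t_m(x)=\sum_k\big(x_k^m-(-x_k)^m\big)$, $m\,t^*_m(y)=\sum_k\big(y_k^m-(-y_k)^m\big)$,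 and let $\tau_r=\tau_r(t(x),t^*(y))$, a formal power series in $x,y$. Let $$\Delta(x)=\prod_{i<j}\frac{x_i-x_j}{x_i+x_j},\qquad \frac{x_i-x_j}{x_i+x_j}:=1+2\sum_{n\ge1}\Big(-\frac{x_j}{x_i}\Big)^n ,$$ and define $\Delta(y)$ in the same way. Let $D_z=z\,\partial/\partial z$, and let $r(-D_{x_i})$ act on Laurent monomials by $r(-D_{x_i})\prod_l x_l^{n_l}=r(-n_i)\prod_l x_l^{n_l}$; likewise $r(-D_{y_j})$. Put $A_{ij}=y_jx_i\,r(-D_{x_i})$ and $A^*_{ij}=x_iy_j\,r(-D_{y_j})$; inverses of operators below are the formal geometric series $(1-A)^{-1}=1+A+A^2+\cdots$. Then $$\Delta(x)\,\tau_r=\prod_{i=1}^N\prod_{j=1}^{N^*}(1+A_{ij})(1-A_{ij})^{-1}\cdot\Delta(x),\qquad \Delta(y)\,\tau_r=\prod_{i=1}^N\prod_{j=1}^{N^*}(1+A^*_{ij})(1-A^*_{ij})^{-1}\cdot\Delta(y),$$ and the following linear equations hold: $$\Big(D_{y_j}-2\sum_{i=1}^N\frac{A_{ij}}{1-A_{ij}^2}\Big)\big(\Delta(x)\,\tau_r\big)=0\quad(j=1,\dots,N^*),$$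 $$\Big(D_{x_i}-2\sum_{j=1}^{N^*}\frac{A^*_{ij}}{1-(A^*_{ij})^2}\Big)\big(\Delta(y)\,\tau_r\big)=0\quad(i=1,\dots,N).$$ -/

import Mathlib

open Finset

noncomputable section

namespace BKP

/-! ### Neutral fermions on the Fock space -/

/-- The Fock space.  The basis vector indexed by a finite set `S = {n₁ > ⋯ > n_k ≥ 0}` is
`φ_{n₁} ⋯ φ_{n_k} |0⟩`; in particular the empty set gives the vacuum `|0⟩`. -/
abbrev Fock : Type := Finset ℕ →₀ ℂ

/-- The right vacuum vector `|0⟩`. -/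
def vacuum : Fock := Finsupp.single ∅ 1

/-- The left vacuum `⟨0|`, the functional with `⟨0|0⟩ = 1` vanishing on the other basis
vectors. -/
def leftVacuum : Fock →ₗ[ℂ] ℂ := Finsupp.lapply ∅

/-- The sign obtained by moving a fermion with index `n` or `-n` past those `φ_s`, `s ∈ S`,
with `s > n`. -/
def sgn (S : Finset ℕ) (n : ℕ) : ℂ := (-1) ^ #{s ∈ S | n < s}

/-- The action of the neutral fermion `φ_m` on a basis vector. -/
def phiBasis (m : ℤ) (S : Finset ℕ) : Fock :=
  let n := m.natAbs
  if 0 < m then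
    if n ∈ S then 0 else Finsupp.single (insert n S) (sgn S n)
  else if m = 0 then
    if 0 ∈ S then Finsupp.single (S.erase 0) (sgn S 0 / 2)
    else Finsupp.single (insert 0 S) (sgn S 0)
  else
    if n ∈ S then Finsupp.single (S.erase n) ((-1) ^ n * sgn S n) else 0

/-- The neutral fermion `φ_m`; these satisfy `φ_m φ_n + φ_n φ_m = (-1)^m δ_{m,-n}`,
`φ_m |0⟩ = 0` for `m < 0` and `⟨0| φ_m = 0` for `m > 0`. -/
def phi (m : ℤ) : Module.End ℂ Fock := Finsupp.linearCombination ℂ (phiBasis m)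

/-- `H_n = ½ ∑_{k ∈ ℤ} (-1)^{k+1} φ_k φ_{-k-n}`, for `n` odd.  On each basis vector only
finitely many terms of the sum do not vanish. -/
def H (n : ℤ) : Module.End ℂ Fock :=
  Finsupp.linearCombination ℂ fun S : Finset ℕ =>
    (1 / 2 : ℂ) • ∑ᶠ k : ℤ, (-1 : ℂ) ^ (k + 1) • phi k (phi (-k - n) (Finsupp.single S 1))

/-- `B_k = ½ ∑_{n ∈ ℤ} (-1)^n φ_n φ_{k-n} r(n) r(n-1) ⋯ r(n-k+1)`, for `k > 0` odd.  On each
basis vector only finitely many terms of the sum do not vanish. -/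
def B (r : ℤ → ℂ) (k : ℕ) : Module.End ℂ Fock :=
  Finsupp.linearCombination ℂ fun S : Finset ℕ =>
    (1 / 2 : ℂ) • ∑ᶠ n : ℤ, ((-1 : ℂ) ^ n * ∏ l ∈ range k, r (n - l)) •
      phi n (phi (k - n) (Finsupp.single S 1))

/-! ### The tau function -/

/-- `∑_{m = 1, 3, 5, …} t_m A_m` as a formal power series with operator coefficients, where the
times `t_m` are formal power series.  Only the times with odd index are used, and each monomial
has to occur in finitely many of them. -/
def timesSum {σ : Type} (t : ℕ → MvPowerSeries σ ℂ) (A : ℕ → Module.End ℂ Fock) :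
    MvPowerSeries σ (Module.End ℂ Fock) :=
  fun α => ∑ᶠ m : {m : ℕ // Odd m}, MvPowerSeries.coeff α (t m) • A m

/-- The exponential `∑_p P^p / p!` of a formal power series with operator coefficients and zero
constant term: `P ^ p` has no monomials of degree less than `p`. -/
def expSeries {σ : Type} (P : MvPowerSeries σ (Module.End ℂ Fock)) :
    MvPowerSeries σ (Module.End ℂ Fock) :=
  fun α => ∑ p ∈ range (α.degree + 1),
    ((p.factorial : ℂ)⁻¹) • MvPowerSeries.coeff α (P ^ p)

/-- The BKP tau function of hypergeometric type
`τ_r(t, t*) = ⟨0| exp(∑ t_m H_m) exp(-∑ t*_m B_m) |0⟩`, the sums being over odd `m > 0`. -/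
def tau {σ : Type} (r : ℤ → ℂ) (t t' : ℕ → MvPowerSeries σ ℂ) : MvPowerSeries σ ℂ :=
  fun α => leftVacuum (MvPowerSeries.coeff α
    (expSeries (timesSum t fun m => H m) * expSeries (-timesSum t' (B r))) vacuum)

/-- The times `t_m(z) = (1/m) ∑_k (z_k^m - (-z_k)^m)`. -/
def powerTimes {σ : Type} {n : ℕ} (z : Fin n → MvPowerSeries σ ℂ) (m : ℕ) :
    MvPowerSeries σ ℂ :=
  (m : ℂ)⁻¹ • ∑ k, (z k ^ m - (-z k) ^ m)

/-- `τ_r(t(x), t*(y))` as a formal power series in `x_i` (left variables) and `y_j` (right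
variables). -/
def tauXY (r : ℤ → ℂ) (N M : ℕ) : MvPowerSeries (Fin N ⊕ Fin M) ℂ :=
  tau r (powerTimes fun i : Fin N => MvPowerSeries.X (Sum.inl i))
    (powerTimes fun j : Fin M => MvPowerSeries.X (Sum.inr j))

/-! ### Laurent series in `x₁, …, x_N` -/

/-- Exponents of Laurent monomials in `x₁, …, x_N`, ordered by comparing the exponents of `x_N`
first, then those of `x_{N-1}`, and so on.  In this order all `x_i` are positive, and so is
`x_j / x_i` for `i < j`. -/
abbrev Expo (N : ℕ) : Type := Lex ((Fin N)ᵒᵈ → ℤ)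

/-- The exponent of `x_i` in the monomial with exponents `a`. -/
def expo {N : ℕ} (a : Expo N) (i : Fin N) : ℤ := ofLex a (OrderDual.toDual i)

/-- The field of iterated formal Laurent series in `x₁, …, x_N` in which quotients are expanded
in the domain `|x₁| > |x₂| > ⋯ > |x_N|`. -/
abbrev Laurent (N : ℕ) : Type := HahnSeries (Expo N) ℂ

instance (N : ℕ) : CommRing (Laurent N) := HahnSeries.instCommRing

instance (N : ℕ) : Algebra ℂ (Laurent N) := HahnSeries.instAlgebra

/-- The variable `x_i`. -/
def xvar {N : ℕ} (i : Fin N) : Laurent N :=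
  HahnSeries.single (toLex (Pi.single (OrderDual.toDual i) 1)) 1

/-- `Δ(x) = ∏_{i<j} (x_i - x_j) / (x_i + x_j)`, each factor being the series
`1 + 2 ∑_{n ≥ 1} (-x_j / x_i)^n`. -/
def Delta (N : ℕ) : Laurent N :=
  ∏ i : Fin N, ∏ j ∈ Ioi i, (xvar i - xvar j) / (xvar i + xvar j)

/-- The operator `f(D_{x_i})`, `D_{x_i} = x_i ∂/∂x_i`: it multiplies a monomial `∏ x_l^{n_l}` by
`f(n_i)`. -/
def funcEuler {N : ℕ} (f : ℤ → ℂ) (i : Fin N) : Module.End ℂ (Laurent N) where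
  toFun F :=
    { coeff := fun a => f (expo a i) * F.coeff a
      isPWO_support' := F.isPWO_support.mono fun a ha => by
        simp only [Function.mem_support, ne_eq, mul_eq_zero, not_or] at ha
        exact ha.2 }
  map_add' F G := by ext a; simp [mul_add]
  map_smul' c F := by ext a; simp [mul_left_comm]

/-! ### Formal power series in `y₁, …, y_M` over Laurent series in `x₁, …, x_N` -/

/-- Formal power series in `y₁, …, y_M` with coefficients in the Laurent series in
`x₁, …, x_N`. -/
abbrev Mixed (N M : ℕ) : Type := MvPowerSeries (Fin M) (Laurent N)

lemma isPWO_nonneg (N : ℕ) : {a : Expo N | ∀ i, 0 ≤ expo a i}.IsPWO := by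
  have h : (Set.univ : Set (Fin N → ℕ)).IsPWO := Set.isPWO_of_wellQuasiOrderedLE _
  have hm : Monotone fun b : Fin N → ℕ => (toLex fun i => (b (OrderDual.ofDual i) : ℤ) : Expo N) :=
    fun b c hbc => Pi.toLex_monotone fun i => Int.ofNat_le.2 (hbc _)
  refine (h.image_of_monotone hm).mono fun a ha => ⟨fun i => (expo a i).toNat, trivial, ?_⟩
  funext i
  exact Int.toNat_of_nonneg (ha (OrderDual.ofDual i))

/-- A formal power series in the `x_i` (left variables) and the `y_j` (right variables), viewed
as a power series in the `y_j` whose coefficients are series in the `x_i`. -/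
def expand {N M : ℕ} (G : MvPowerSeries (Fin N ⊕ Fin M) ℂ) : Mixed N M := fun m =>
  { coeff := fun a =>
      if ∀ i, 0 ≤ expo a i then
        MvPowerSeries.coeff
          (Finsupp.sumElim (Finsupp.equivFunOnFinite.symm fun i => (expo a i).toNat) m) G
      else 0
    isPWO_support' := (isPWO_nonneg N).mono fun a ha => by
      by_contra h
      exact ha (if_neg h) }

/-- A linear operator on Laurent series in `x`, applied to the coefficients of a power series in
`y`. -/
def onCoeffs {N M : ℕ} (T : Module.End ℂ (Laurent N)) : Module.End ℂ (Mixed N M) where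
  toFun F := fun m => T (MvPowerSeries.coeff m F)
  map_add' F G := by funext m; exact T.map_add _ _
  map_smul' c F := by funext m; exact T.map_smul _ _

/-- The operator `D_{y_j} = y_j ∂/∂y_j`. -/
def eulerY {N M : ℕ} (j : Fin M) : Module.End ℂ (Mixed N M) :=
  LinearMap.mulLeft ℂ (MvPowerSeries.X j : Mixed N M) *
    (MvPowerSeries.pderiv (Laurent N) j).toLinearMap.restrictScalars ℂ

/-- The operator `y_j x_i r(-D_{x_i})`. -/
def shiftOp {N M : ℕ} (r : ℤ → ℂ) (i : Fin N) (j : Fin M) : Module.End ℂ (Mixed N M) :=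
  LinearMap.mulLeft ℂ (MvPowerSeries.X j : Mixed N M) *
    onCoeffs (LinearMap.mulLeft ℂ (xvar i) * funcEuler (fun n => r (-n)) i)

/-- The formal series `(1 - A)⁻¹ = 1 + A + A² + ⋯` of an operator `A` which raises the degree
in `y` by at least one, so that `A ^ k` does not contribute in degrees less than `k`. -/
def geom {N M : ℕ} (A : Module.End ℂ (Mixed N M)) : Module.End ℂ (Mixed N M) where
  toFun F := fun m => ∑ k ∈ range (m.degree + 1), MvPowerSeries.coeff m ((A ^ k) F)
  map_add' F G := by
    funext m
    simp only [map_add, sum_add_distrib]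
    rfl
  map_smul' c F := by
    funext m
    simp only [map_smul, RingHom.id_apply]
    exact (smul_sum (r := c)).symm

/-- `Δ(x)`, as a power series in `y` which is constant. -/
def DeltaX (N M : ℕ) : Mixed N M := MvPowerSeries.C (Delta N)

/-- The product of the operators
`(1 + y_j x_i r(-D_{x_i})) (1 - y_j x_i r(-D_{x_i}))⁻¹` over all `i` and `j`; the factors
commute. -/
def prodOp (r : ℤ → ℂ) (N M : ℕ) : Module.End ℂ (Mixed N M) :=
  (List.ofFn fun i : Fin N => (List.ofFn fun j : Fin M =>
    (1 + shiftOp r i j) * geom (shiftOp r i j)).prod).prod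

/-- The operator `D_{y_j} - 2 ∑_i y_j x_i r(-D_{x_i}) / (1 - (y_j x_i r(-D_{x_i}))²)`. -/
def linOp (r : ℤ → ℂ) (N M : ℕ) (j : Fin M) : Module.End ℂ (Mixed N M) :=
  eulerY j - 2 • ∑ i : Fin N, shiftOp r i j * geom (shiftOp r i j ^ 2)

end BKP

end

noncomputable section

namespace BKP

/-! ### The canonical anticommutation relations -/

/-! Write λ = ⟨0| + √2⟨0|φ₀ (`lam`) and V(x) = exp(∑ 2xᵐHₘ/m), the sum being over odd m (`vert`). At
the odd power sums, exp(∑ tₘHₘ) is the product of the V(x_i) (`coeff_exp_H`). The vectors it acts on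
are even, so ⟨0| may be replaced by λ (`lam_of_parity`). The gain is that λV(x) = λΦ(x) with Φ(x) =
√2φ(-1/x) (`lam_vert`). Moreover [Hₘ, φₙ] = φₙ₋ₘ gives (x_i + x_j)V(x_j)Φ(x_i) = (x_i -
x_j)Φ(x_i)V(x_j) (`vertInt_mul_ferm`). Replacing every V by a fermion yields Δ(x)·λV(x₁)⋯V(x_N) =
λΦ(x_N)⋯Φ(x₁) (`Delta_mul_vertGen`), an identity in the field of iterated Laurent series.

By the symmetry of r, [Bₘ, φₙ] = -r(n+1)⋯r(n+m)φₙ₊ₘ, while λBₘ = 0. Moving Bₘ to the left through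
the fermions therefore turns -Bₘ into the operator ∑ᵢ(xᵢr(-Dᵢ))ᵐ on Laurent series (`fermGen_B`).
Applied to the vacuum this gives Δ(x)τ = exp(∑ t*ₘ ∑ᵢ(xᵢr(-Dᵢ))ᵐ)Δ(x) (`coeff_DeltaX_mul`).
Differentiating the exponential in y_j gives the linear equations (`linOp_DeltaX_mul`). The product
of the (1 + A)(1 - A)⁻¹ has the same logarithmic derivative (`eulerY_prodOp`), and a solution is
determined by its value at y = 0 (`eq_zero_of_linOp`), whence the product formula.

The formulas in Δ(y) follow from the symmetry of τ in x and y. For the bilinear form in which φₙ has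
adjoint (-1)ⁿφ₋ₙ, the adjoint of Hₘ is H₋ₘ (`form_H`). A diagonal self-adjoint operator intertwines
H₋ₘ with -Bₘ (`diag_H`). So τ is the pairing of exp(∑ tₘH₋ₘ)|0⟩ with the diagonal operator applied
to exp(∑ t*ₘH₋ₘ)|0⟩, which is symmetric (`rename_tauXY`). -/

/-- The sign by which the indices `n < m` and `m ≤ n` are told apart. -/
def sg (n m : ℕ) : ℂ := if n < m then -1 else 1

lemma sgn_insert {S : Finset ℕ} {m : ℕ} (h : m ∉ S) (n : ℕ) :
    sgn (insert m S) n = sgn S n * sg n m := by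
  unfold sgn sg
  rw [filter_insert]
  split_ifs with hn
  · rw [card_insert_of_notMem (by simp [h]), pow_succ]
  · rw [mul_one]

lemma sg_mul_self (n m : ℕ) : sg n m * sg n m = 1 := by
  unfold sg; split_ifs <;> norm_num

lemma sgn_erase {S : Finset ℕ} {m : ℕ} (h : m ∈ S) (n : ℕ) :
    sgn (S.erase m) n = sgn S n * sg n m := by
  have := sgn_insert (notMem_erase m S) n
  rw [insert_erase h] at this
  rw [this, mul_assoc, sg_mul_self, mul_one]

lemma sgn_mul_self (S : Finset ℕ) (n : ℕ) : sgn S n * sgn S n = 1 := by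
  unfold sgn; rw [← mul_pow]; norm_num

/-- For distinct indices exactly one of the two signs is -1. This cancellation is what makes
operators of different indices anticommute. -/
lemma sg_add_sg {n m : ℕ} (h : n ≠ m) : sg n m + sg m n = 0 := by
  unfold sg; rcases lt_or_gt_of_ne h with h | h <;> simp [h, not_lt_of_gt h]

lemma sg_self (n : ℕ) : sg n n = 1 := by simp [sg]

/-- The operator adding the index `n`. -/
def create (n : ℕ) : Module.End ℂ Fock :=
  Finsupp.linearCombination ℂ fun S => if n ∈ S then 0 else Finsupp.single (insert n S) (sgn S n)

/-- The operator removing the index `n`. -/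
def annih (n : ℕ) : Module.End ℂ Fock :=
  Finsupp.linearCombination ℂ fun S => if n ∈ S then Finsupp.single (S.erase n) (sgn S n) else 0

lemma create_single (n : ℕ) (S : Finset ℕ) (c : ℂ) : create n (Finsupp.single S c) =
    if n ∈ S then 0 else Finsupp.single (insert n S) (c * sgn S n) := by
  rw [create, Finsupp.linearCombination_single]; split_ifs <;> simp

lemma annih_single (n : ℕ) (S : Finset ℕ) (c : ℂ) : annih n (Finsupp.single S c) =
    if n ∈ S then Finsupp.single (S.erase n) (c * sgn S n) else 0 := by
  rw [annih, Finsupp.linearCombination_single]; split_ifs <;> simp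

lemma phi_single (m : ℤ) (S : Finset ℕ) : phi m (Finsupp.single S 1) = phiBasis m S := by
  rw [phi, Finsupp.linearCombination_single, one_smul]

lemma end_ext {V : Type*} [AddCommMonoid V] [Module ℂ V] {f g : Fock →ₗ[ℂ] V}
    (h : ∀ S, f (Finsupp.single S 1) = g (Finsupp.single S 1)) : f = g :=
  Finsupp.lhom_ext' fun S => LinearMap.ext_ring (h S)

lemma phi_of_pos {m : ℤ} (h : 0 < m) : phi m = create m.natAbs := by
  refine end_ext fun S => ?_
  rw [phi_single, create_single, one_mul]
  simp only [phiBasis, if_pos h]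

lemma phi_of_neg {m : ℤ} (h : m < 0) : phi m = ((-1 : ℂ) ^ m) • annih m.natAbs := by
  refine end_ext fun S => ?_
  have : ((-1 : ℂ) ^ m) = (-1) ^ m.natAbs := by
    obtain ⟨n, rfl⟩ : ∃ n : ℕ, m = -n := ⟨m.natAbs, by omega⟩
    rw [Int.natAbs_neg, Int.natAbs_natCast, zpow_neg, zpow_natCast, ← inv_pow]; norm_num
  rw [phi_single, LinearMap.smul_apply, annih_single, one_mul, this]
  simp only [phiBasis, if_neg h.not_gt, if_neg h.ne]
  split_ifs <;> simp

lemma phi_zero : phi 0 = create 0 + (1 / 2 : ℂ) • annih 0 := by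
  refine end_ext fun S => ?_
  rw [phi_single, LinearMap.add_apply, LinearMap.smul_apply, annih_single, create_single, one_mul]
  simp only [phiBasis, lt_irrefl, if_true, if_false, Int.natAbs_zero]
  split_ifs
  · rw [zero_add, Finsupp.smul_single, smul_eq_mul, mul_comm, mul_one_div]
  · simp

lemma create_mul_create (m n : ℕ) : create m * create n + create n * create m = 0 := by
  refine end_ext fun S => ?_
  simp only [LinearMap.add_apply, Module.End.mul_apply, create_single, LinearMap.zero_apply]
  by_cases hn : n ∈ S <;> by_cases hm : m ∈ S
  · simp [hn, hm]
  · simp [hn, hm, create_single]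
  · simp [hn, hm, create_single]
  · by_cases h : m = n
    · subst h; simp [hn, create_single]
    · simp only [hn, hm, if_false, create_single, mem_insert, h, Ne.symm h, or_self,
        sgn_insert hn, sgn_insert hm, insert_comm m n, ← Finsupp.single_add]
      rw [show 1 * sgn S n * (sgn S m * sg m n) + 1 * sgn S m * (sgn S n * sg n m) =
        sgn S n * sgn S m * (sg m n + sg n m) by ring, sg_add_sg h, mul_zero, Finsupp.single_zero]

lemma annih_mul_annih (m n : ℕ) : annih m * annih n + annih n * annih m = 0 := by
  refine end_ext fun S => ?_
  simp only [LinearMap.add_apply, Module.End.mul_apply, annih_single, LinearMap.zero_apply]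
  by_cases hn : n ∈ S <;> by_cases hm : m ∈ S
  · by_cases h : m = n
    · subst h; simp [hn, annih_single]
    · simp only [hn, hm, if_true, annih_single, mem_erase, h, Ne.symm h, and_true, ne_eq,
        not_false_eq_true,
        sgn_erase hn, sgn_erase hm, erase_right_comm (a := n) (b := m), ← Finsupp.single_add]
      rw [show 1 * sgn S n * (sgn S m * sg m n) + 1 * sgn S m * (sgn S n * sg n m) =
        sgn S n * sgn S m * (sg m n + sg n m) by ring, sg_add_sg h, mul_zero, Finsupp.single_zero]
  · simp [hn, hm, annih_single]
  · simp [hn, hm, annih_single]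
  · simp [hn, hm]

lemma create_mul_annih (m n : ℕ) :
    create m * annih n + annih n * create m = if m = n then 1 else 0 := by
  refine end_ext fun S => ?_
  simp only [LinearMap.add_apply, Module.End.mul_apply, create_single, annih_single]
  by_cases h : m = n
  · subst h
    by_cases hm : m ∈ S
    · simp [hm, create_single, insert_erase, sgn_erase, sg_self, sgn_mul_self]
    · simp [hm, annih_single, sgn_insert, sg_self, sgn_mul_self]
  · by_cases hn : n ∈ S <;> by_cases hm : m ∈ S
    · simp [hn, hm, h, create_single]
    · simp only [hn, hm, h, if_true, if_false, create_single, annih_single, mem_erase, mem_insert,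
        and_false, or_true, sgn_erase hn, sgn_insert hm, erase_insert_of_ne h,
        ← Finsupp.single_add, LinearMap.zero_apply]
      rw [show 1 * sgn S n * (sgn S m * sg m n) + 1 * sgn S m * (sgn S n * sg n m) =
        sgn S n * sgn S m * (sg m n + sg n m) by ring, sg_add_sg h, mul_zero, Finsupp.single_zero]
    · simp [hn, hm, h]
    · simp [hn, hm, h, annih_single, Ne.symm h]

lemma anticomm_add_smul {R : Type*} [Ring R] [Algebra ℂ R] (x y z : R) (t : ℂ) :
    (x + t • y) * z + z * (x + t • y) = (x * z + z * x) + t • (y * z + z * y) := by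
  simp only [smul_mul_assoc, mul_smul_comm, mul_add, add_mul, smul_add]; abel

lemma anticomm_smul {R : Type*} [Ring R] [Algebra ℂ R] (x y : R) (t : ℂ) :
    (t • y) * x + x * (t • y) = t • (y * x + x * y) := by
  simp only [smul_mul_assoc, mul_smul_comm, smul_add]

/-- The anticommutation relations of the neutral fermions. -/
theorem phi_mul_phi (m n : ℤ) :
    phi m * phi n + phi n * phi m = if m = -n then ((-1 : ℂ) ^ n) • 1 else 0 := by
  -- The relation is symmetric in m and n, because (-1)ᵐ = (-1)ⁿ when m = -n.
  have key : ∀ m n : ℤ, m ≤ n →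
      phi m * phi n + phi n * phi m = if m = -n then ((-1 : ℂ) ^ n) • 1 else 0 := by
    intro m n hmn
    rcases lt_trichotomy m 0 with hm | rfl | hm <;> rcases lt_trichotomy n 0 with hn | rfl | hn
    · rw [phi_of_neg hm, phi_of_neg hn, if_neg (by omega), smul_mul_smul_comm, smul_mul_smul_comm,
        mul_comm ((-1 : ℂ) ^ n), ← smul_add, annih_mul_annih, smul_zero]
    · rw [phi_of_neg hm, phi_zero, if_neg (by omega)]
      have h1 := annih_mul_annih m.natAbs 0
      have h2 := create_mul_annih 0 m.natAbs
      rw [if_neg (by omega)] at h2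
      have e := anticomm_add_smul (create 0) (annih 0) (annih m.natAbs) (1 / 2)
      rw [h2, add_comm (annih 0 * _), h1, smul_zero, add_zero, add_comm] at e
      refine (anticomm_smul _ (annih m.natAbs) _).trans ?_
      rw [e, smul_zero]
    · rw [phi_of_neg hm, phi_of_pos hn, smul_mul_assoc, mul_smul_comm, ← smul_add,
        add_comm, create_mul_annih]
      have hh : n.natAbs = m.natAbs ↔ m = -n := by omega
      simp only [hh]
      split_ifs with h
      · rw [h, zpow_neg, ← inv_zpow]; norm_num
      · simp
    · omega
    · have h1 := annih_mul_annih 0 0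
      have h2 := create_mul_annih 0 0
      have h3 := create_mul_create 0 0
      rw [if_pos rfl] at h2
      rw [if_pos neg_zero.symm, phi_zero, zpow_zero, one_smul]
      have e1 := anticomm_add_smul (create 0) (annih 0) (create 0) (1 / 2)
      have e2 := anticomm_add_smul (create 0) (annih 0) (annih 0) (1 / 2)
      rw [h3, add_comm (annih 0 * _), h2, zero_add, add_comm] at e1
      rw [h1, h2, smul_zero, add_zero, add_comm] at e2
      refine (anticomm_add_smul (create 0) (annih 0) (create 0 + (1 / 2 : ℂ) • annih 0) _).trans ?_
      rw [e1, e2, ← add_smul]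
      norm_num
    · rw [phi_zero, phi_of_pos hn, if_neg (by omega)]
      have h1 := create_mul_create n.natAbs 0
      have h2 := create_mul_annih n.natAbs 0
      rw [if_neg (by omega)] at h2
      refine (anticomm_add_smul (create 0) (annih 0) (create n.natAbs) _).trans ?_
      rw [add_comm (create 0 * _), add_comm (annih 0 * _), h1, h2, smul_zero, add_zero]
    · omega
    · omega
    · rw [phi_of_pos hm, phi_of_pos hn, if_neg (by omega), create_mul_create]
  rcases le_total m n with h | h
  · exact key m n h
  · rw [add_comm, key n m h]
    by_cases e : m = -n
    · rw [if_pos e, if_pos (by omega), e, zpow_neg, ← inv_zpow]; norm_num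
    · rw [if_neg e, if_neg (by omega)]

lemma phi_phi_apply (m n : ℤ) (v : Fock) : phi m (phi n v) =
    (if m = -n then ((-1 : ℂ) ^ n) • v else 0) - phi n (phi m v) := by
  have := LinearMap.congr_fun (phi_mul_phi m n) v
  simp only [LinearMap.add_apply, Module.End.mul_apply] at this
  rw [eq_sub_iff_add_eq, this]
  split_ifs <;> simp

lemma phi_vacuum {m : ℤ} (h : m < 0) : phi m vacuum = 0 := by
  rw [phi_of_neg h, LinearMap.smul_apply, vacuum, annih_single]; simp

lemma leftVacuum_phi {m : ℤ} (h : 0 < m) (v : Fock) : leftVacuum (phi m v) = 0 := by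
  suffices leftVacuum ∘ₗ phi m = 0 from LinearMap.congr_fun this v
  refine end_ext fun S => ?_
  rw [phi_of_pos h, LinearMap.comp_apply, create_single]
  split_ifs <;> simp [leftVacuum]

/-- A vector is annihilated by the fermions of sufficiently negative index. -/
lemma exists_phi_eq_zero (v : Fock) : ∃ b : ℕ, ∀ k : ℤ, k < -b → phi k v = 0 := by
  induction v using Finsupp.induction_linear with
  | zero => exact ⟨0, by simp⟩
  | add f g hf hg =>
    obtain ⟨b, hb⟩ := hf
    obtain ⟨c, hc⟩ := hg
    exact ⟨b + c, fun k hk => by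
      rw [map_add, hb k (by push_cast at hk; omega), hc k (by push_cast at hk; omega), add_zero]⟩
  | single S c =>
    refine ⟨S.sup id, fun k hk => ?_⟩
    rw [phi_of_neg (by omega), LinearMap.smul_apply, annih_single, if_neg, smul_zero]
    intro h
    have := le_sup (f := id) h
    simp only [id] at this
    omega

/-- An index above all others passes no fermion, so its sign is +1. Basis vectors are thus built
from the vacuum by adding ever larger indices, which suits `Finset.induction_on_max`. -/
lemma phi_single_of_lt {S : Finset ℕ} {a : ℕ} (ha : ∀ x ∈ S, x < a) :
    phi a (Finsupp.single S 1) = Finsupp.single (insert a S) 1 := by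
  have hn : a ∉ S := fun h => lt_irrefl _ (ha a h)
  have hs : sgn S a = 1 := by
    unfold sgn
    rw [filter_eq_empty_iff.2 fun x hx => not_lt_of_gt (ha x hx)]; simp
  rw [phi_single]
  rcases Nat.eq_zero_or_pos a with rfl | hpos
  · simp [phiBasis, hn, hs]
  · simp [phiBasis, hn, hs, hpos]

/-- Every vector is obtained from the vacuum by the creation operators. -/
lemma fock_induction {p : Fock → Prop} (vac : p vacuum) (add : ∀ u v, p u → p v → p (u + v))
    (smul : ∀ (c : ℂ) v, p v → p (c • v)) (hphi : ∀ (n : ℕ) v, p v → p (phi n v)) (v : Fock) :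
    p v := by
  have hS : ∀ S : Finset ℕ, p (Finsupp.single S 1) := by
    intro S
    induction S using Finset.induction_on_max with
    | empty => exact vac
    | insert a S ha ih => rw [← phi_single_of_lt ha]; exact hphi a _ ih
  induction v using Finsupp.induction_linear with
  | zero => simpa using smul 0 _ vac
  | add f g hf hg => exact add _ _ hf hg
  | single S c => simpa using smul c _ (hS S)

/-- The vacuum is cyclic for the creation operators. -/
lemma end_eq_zero_of_commute {X : Module.End ℂ Fock} (h : ∀ n v, X (phi n v) = phi n (X v))
    (h0 : X vacuum = 0) : X = 0 := by
  refine LinearMap.ext fun v => ?_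
  refine fock_induction (p := fun v => X v = 0) h0 ?_ ?_ ?_ v
  · intro u v hu hv; rw [map_add, hu, hv, add_zero]
  · intro c v hv; rw [map_smul, hv, smul_zero]
  · intro n v hv; rw [h, hv, map_zero]

/-! ### Bilinear expressions in the fermions -/

/-- The operator `½ ∑_k c_k φ_k φ_{s-k}`. -/
def bil (c : ℤ → ℂ) (s : ℤ) : Module.End ℂ Fock :=
  Finsupp.linearCombination ℂ fun S : Finset ℕ =>
    (1 / 2 : ℂ) • ∑ᶠ k : ℤ, c k • phi k (phi (s - k) (Finsupp.single S 1))

lemma H_eq_bil (n : ℤ) : H n = bil (fun k => (-1) ^ (k + 1)) (-n) := by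
  have : ∀ k : ℤ, -n - k = -k - n := fun k => by ring
  simp only [H, bil, this]

lemma B_eq_bil (r : ℤ → ℂ) (k : ℕ) :
    B r k = bil (fun n => (-1) ^ n * ∏ l ∈ range k, r (n - l)) k := rfl

lemma phi_phi_swap {s : ℤ} (hs : s ≠ 0) (k : ℤ) (v : Fock) :
    phi k (phi (s - k) v) = -phi (s - k) (phi k v) := by
  rw [phi_phi_apply, if_neg (by omega), zero_sub]

/-- For large k the inner fermion annihilates v. For very negative k the outer one does so after
being moved inside, which costs only a sign because s ≠ 0. -/
lemma exists_phi_phi_eq_zero {s : ℤ} (hs : s ≠ 0) (v : Fock) :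
    ∃ K : Finset ℤ, ∀ k ∉ K, phi k (phi (s - k) v) = 0 := by
  obtain ⟨b, hb⟩ := exists_phi_eq_zero v
  refine ⟨Icc (-b) (s + b), fun k hk => ?_⟩
  rw [mem_Icc, not_and_or, not_le, not_le] at hk
  rcases hk with h | h
  · rw [phi_phi_swap hs, hb k h, map_zero, neg_zero]
  · rw [hb (s - k) (by omega), map_zero]

lemma finsum_phi_phi {s : ℤ} {v : Fock} {K : Finset ℤ}
    (hK : ∀ k ∉ K, phi k (phi (s - k) v) = 0) (c : ℤ → ℂ) :
    ∑ᶠ k : ℤ, c k • phi k (phi (s - k) v) = ∑ k ∈ K, c k • phi k (phi (s - k) v) := by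
  refine finsum_eq_sum_of_support_subset _ fun k hk => ?_
  by_contra h
  exact hk (by simp only [hK k h, smul_zero])

/-- The definition fixes the operator on basis vectors only. Linearity of the infinite sum needs a
common finite support for the summands. -/
lemma bil_apply (c : ℤ → ℂ) {s : ℤ} (hs : s ≠ 0) (v : Fock) :
    bil c s v = (1 / 2 : ℂ) • ∑ᶠ k : ℤ, c k • phi k (phi (s - k) v) := by
  induction v using Finsupp.induction_linear with
  | zero => simp
  | add f g hf hg =>
    obtain ⟨K, hK⟩ := exists_phi_phi_eq_zero hs f
    obtain ⟨K', hK'⟩ := exists_phi_phi_eq_zero hs g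
    rw [map_add, hf, hg, ← smul_add,
      finsum_phi_phi (K := K ∪ K') fun k hk => hK k fun h => hk (mem_union_left _ h),
      finsum_phi_phi (K := K ∪ K') fun k hk => hK' k fun h => hk (mem_union_right _ h),
      finsum_phi_phi (K := K ∪ K'), ← sum_add_distrib]
    · simp only [map_add, smul_add]
    · intro k hk
      rw [mem_union, not_or] at hk
      rw [map_add, map_add, hK k hk.1, hK' k hk.2, add_zero]
  | single S a =>
    have e : (Finsupp.single S a : Fock) = a • Finsupp.single S 1 := by simp
    obtain ⟨K, hK⟩ := exists_phi_phi_eq_zero hs (Finsupp.single S 1)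
    rw [e, map_smul, bil, Finsupp.linearCombination_single, one_smul, finsum_phi_phi hK,
      finsum_phi_phi (K := K) fun k hk => by rw [map_smul, map_smul, hK k hk, smul_zero],
      smul_comm, smul_sum]
    simp only [map_smul, smul_comm a]

lemma bil_eq_sum (c : ℤ → ℂ) {s : ℤ} (hs : s ≠ 0) {v : Fock} {K : Finset ℤ}
    (hK : ∀ k ∉ K, phi k (phi (s - k) v) = 0) :
    bil c s v = (1 / 2 : ℂ) • ∑ k ∈ K, c k • phi k (phi (s - k) v) := by
  rw [bil_apply c hs, finsum_phi_phi hK]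

/-- Moving φₙ to the left through φₖφₛ₋ₖ leaves a remainder only at k = s + n and k = -n, and both
remainders are multiples of φₛ₊ₙ. -/
lemma bil_phi (c : ℤ → ℂ) {s : ℤ} (hs : s ≠ 0) (n : ℤ) (v : Fock) :
    bil c s (phi n v) = phi n (bil c s v) +
      (1 / 2 * (-1) ^ n * (c (s + n) - c (-n))) • phi (s + n) v := by
  obtain ⟨K₁, h₁⟩ := exists_phi_phi_eq_zero hs v
  obtain ⟨K₂, h₂⟩ := exists_phi_phi_eq_zero hs (phi n v)
  -- The two exceptional indices are added so that both remainders are certainly counted.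
  set K := K₁ ∪ K₂ ∪ {s + n, -n} with hK
  rw [bil_eq_sum c hs (K := K) (v := v) fun k hk => h₁ k fun h => hk (by simp [hK, h]),
    bil_eq_sum c hs (K := K) (v := phi n v) fun k hk => h₂ k fun h => hk (by simp [hK, h])]
  have term : ∀ k ∈ K, c k • phi k (phi (s - k) (phi n v)) =
      c k • phi n (phi k (phi (s - k) v)) +
      ((if k = s + n then (c (s + n) * (-1) ^ n) • phi (s + n) v else 0) -
        (if k = -n then (c (-n) * (-1) ^ n) • phi (s + n) v else 0)) := by
    intro k _
    rw [phi_phi_apply (s - k) n, map_sub, phi_phi_apply k n]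
    have h1 : s - k = -n ↔ k = s + n := by omega
    simp only [h1]
    by_cases e1 : k = s + n
    · by_cases e2 : k = -n
      · rw [if_pos e1, if_pos e2, if_pos e1, if_pos e2, map_smul, ← e1, ← e2,
          show s - k = k by omega, sub_sub_cancel, sub_self, add_zero]
      · rw [if_pos e1, if_neg e2, if_pos e1, if_neg e2, map_smul, ← e1, smul_sub, mul_smul,
          zero_sub, smul_neg]
        abel
    · by_cases e2 : k = -n
      · rw [if_neg e1, if_pos e2, if_neg e1, if_pos e2, map_zero, mul_smul, e2, sub_neg_eq_add,
          zero_sub, zero_sub, neg_sub, smul_sub, sub_eq_add_neg]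
      · rw [if_neg e1, if_neg e2, if_neg e1, if_neg e2, map_zero]
        simp
  rw [sum_congr rfl term, sum_add_distrib, sum_sub_distrib, sum_ite_eq', sum_ite_eq',
    if_pos (by simp [hK]), if_pos (by simp [hK]), ← sub_smul, smul_add, map_smul, map_sum,
    smul_smul]
  simp only [map_smul]
  congr 2
  ring

/-- If s < 0 then k or s - k is negative, and that fermion can be placed next to the vacuum. -/
lemma bil_vacuum (c : ℤ → ℂ) {s : ℤ} (hs : s < 0) : bil c s vacuum = 0 := by
  rw [bil_eq_sum c hs.ne (K := ∅), sum_empty, smul_zero]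
  intro k _
  rcases lt_or_ge k 0 with h | h
  · rw [phi_phi_swap hs.ne, phi_vacuum h, map_zero, neg_zero]
  · rw [phi_vacuum (by omega), map_zero]

lemma map_bil_eq_zero {V : Type*} [AddCommGroup V] [Module ℂ V] (f : Fock →ₗ[ℂ] V)
    (hf : ∀ k : ℤ, 0 < k → ∀ v, f (phi k v) = 0) (c : ℤ → ℂ) {s : ℤ} (hs : 0 < s) (v : Fock) :
    f (bil c s v) = 0 := by
  obtain ⟨K, hK⟩ := exists_phi_phi_eq_zero hs.ne' v
  rw [bil_eq_sum c hs.ne' hK, map_smul, map_sum, sum_eq_zero, smul_zero]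
  intro k _
  rw [map_smul]
  rcases lt_or_ge 0 k with h | h
  · rw [hf k h, smul_zero]
  · rw [phi_phi_swap hs.ne', map_neg, hf (s - k) (by omega), neg_zero, smul_zero]

lemma neg_one_zpow_mul_self (n : ℤ) : (-1 : ℂ) ^ n * (-1) ^ n = 1 := by
  rw [← mul_zpow]; norm_num

lemma neg_one_zpow_neg (n : ℤ) : (-1 : ℂ) ^ (-n) = (-1) ^ n := by
  rw [zpow_neg, ← inv_zpow]; norm_num

lemma neg_one_zpow_add_odd (n : ℤ) {m : ℕ} (hm : Odd m) :
    (-1 : ℂ) ^ (n + m) = -(-1) ^ n := by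
  rw [zpow_add₀ (by norm_num), zpow_natCast, hm.neg_one_pow, mul_neg_one]

/-- For odd m the two remainders in `bil_phi` have equal sign and add up to 1; for even m they would
cancel. -/
lemma H_phi {m : ℕ} (hm : Odd m) (n : ℤ) (v : Fock) :
    H m (phi n v) = phi n (H m v) + phi (n - m) v := by
  have h0 := hm.pos
  rw [H_eq_bil, bil_phi _ (by omega)]
  have e : (1 / 2 * (-1) ^ n * ((-1) ^ (-(m : ℤ) + n + 1) - (-1) ^ (-n + 1)) : ℂ) = 1 := by
    have e1 : (-1 : ℂ) ^ (-(m : ℤ) + n + 1) = (-1) ^ n := by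
      rw [show -(m : ℤ) + n + 1 = -(m : ℤ) + (n + 1) by ring, zpow_add₀ (by norm_num),
        zpow_add₀ (by norm_num), neg_one_zpow_neg, zpow_natCast, hm.neg_one_pow]
      norm_num
    have e2 : (-1 : ℂ) ^ (-n + 1) = -(-1) ^ n := by
      rw [zpow_add₀ (by norm_num), neg_one_zpow_neg]; norm_num
    rw [e1, e2]
    linear_combination neg_one_zpow_mul_self n
  rw [e, one_smul, show -(m : ℤ) + n = n - m by ring]

lemma H_vacuum {m : ℕ} (hm : Odd m) : H m vacuum = 0 := by
  have h0 := hm.pos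
  rw [H_eq_bil, bil_vacuum _ (by omega)]

lemma H_commute {m n : ℕ} (hm : Odd m) (hn : Odd n) : Commute (H m) (H n) := by
  refine sub_eq_zero.1 (end_eq_zero_of_commute (fun k v => ?_) ?_)
  · simp only [LinearMap.sub_apply, Module.End.mul_apply, H_phi hm, H_phi hn, map_add]
    rw [show (k : ℤ) - n - m = k - m - n by ring, map_sub]
    abel
  · simp [H_vacuum hm, H_vacuum hn]

/-- By r(n) = r(1 - n) the two remainders in `bil_phi` carry the same product r(n+1)⋯r(n+m), and
since m is odd they add up. -/
lemma B_phi {r : ℤ → ℂ} (hr : ∀ n, r n = r (1 - n)) {m : ℕ} (hm : Odd m) (n : ℤ) (v : Fock) :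
    B r m (phi n v) = phi n (B r m v) - (∏ l ∈ range m, r (n + l + 1)) • phi (n + m) v := by
  have h0 := hm.pos
  rw [B_eq_bil, bil_phi _ (by omega), sub_eq_add_neg (phi n _), ← neg_smul, add_comm (m : ℤ) n]
  congr 2
  have e1 : ∏ l ∈ range m, r (n + m - l) = ∏ l ∈ range m, r (n + l + 1) := by
    rw [← prod_range_reflect]
    refine prod_congr rfl fun l hl => ?_
    rw [mem_range] at hl
    congr 1
    omega
  have e2 : ∏ l ∈ range m, r (-n - l) = ∏ l ∈ range m, r (n + l + 1) :=
    prod_congr rfl fun l _ => by rw [hr]; congr 1; ring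
  rw [e1, e2, neg_one_zpow_add_odd n hm, neg_one_zpow_neg]
  linear_combination (-∏ l ∈ range m, r (n + l + 1)) * neg_one_zpow_mul_self n

/-! ### The functional `⟨0| + √2 ⟨0| φ₀` -/

/-- The complex number `√2`. -/
def rt : ℂ := (Real.sqrt 2 : ℝ)

lemma rt_mul_self : rt * rt = 2 := by
  unfold rt; norm_cast; exact Real.mul_self_sqrt (by norm_num)

lemma rt_ne_zero : rt ≠ 0 := fun h => by
  have := rt_mul_self
  rw [h] at this
  norm_num at this

/-- The functional `⟨0| + √2 ⟨0| φ₀`. -/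
def lam : Fock →ₗ[ℂ] ℂ := leftVacuum + rt • (leftVacuum ∘ₗ phi 0)

lemma lam_apply (v : Fock) : lam v = leftVacuum v + rt * leftVacuum (phi 0 v) := rfl

/-- Since φ₀² = 1/2, the operator √2φ₀ squares to 1, and λ is a fixed vector of its right action.
This explains the coefficient √2 in `lam`. -/
lemma rt_mul_lam_phi_zero (v : Fock) : rt * lam (phi 0 v) = lam v := by
  have h := phi_mul_phi 0 0
  rw [if_pos neg_zero.symm, zpow_zero, one_smul] at h
  have h := congrArg leftVacuum (LinearMap.congr_fun h v)
  simp only [LinearMap.add_apply, Module.End.mul_apply, map_add, Module.End.one_apply] at h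
  rw [lam_apply, lam_apply]
  linear_combination leftVacuum (phi 0 (phi 0 v)) * rt_mul_self + h

lemma lam_phi {m : ℤ} (hm : 0 < m) (v : Fock) : lam (phi m v) = 0 := by
  rw [lam_apply, leftVacuum_phi hm, phi_phi_apply, if_neg (by omega), zero_sub, map_neg,
    leftVacuum_phi hm]
  simp

lemma lam_B (r : ℤ → ℂ) {m : ℕ} (hm : 0 < m) (v : Fock) : lam (B r m v) = 0 :=
  map_bil_eq_zero lam (fun _ hk => lam_phi hk) _ (by exact_mod_cast hm) v

lemma lam_vacuum : lam vacuum = 1 := by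
  rw [lam_apply, vacuum, phi_single]; simp [leftVacuum, phiBasis]

/-! ### Exponentials of formal power series with coefficients in an algebra -/

section Exponential

variable {σ R : Type*} [Semiring R]

/-- The Euler operator of one of the variables. -/
def euler (s : σ) (f : MvPowerSeries σ R) : MvPowerSeries σ R :=
  fun α => α s • MvPowerSeries.coeff α f

lemma coeff_euler (s : σ) (f : MvPowerSeries σ R) (α : σ →₀ ℕ) :
    MvPowerSeries.coeff α (euler s f) = α s • MvPowerSeries.coeff α f := rfl

lemma euler_mul (s : σ) (f g : MvPowerSeries σ R) :
    euler s (f * g) = euler s f * g + f * euler s g := by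
  classical
  ext α
  rw [coeff_euler, map_add, MvPowerSeries.coeff_mul, MvPowerSeries.coeff_mul,
    MvPowerSeries.coeff_mul, ← sum_add_distrib, smul_sum]
  refine sum_congr rfl fun β hβ => ?_
  rw [HasAntidiagonal.mem_antidiagonal] at hβ
  rw [coeff_euler, coeff_euler, ← hβ, Finsupp.add_apply, add_smul, smul_mul_assoc, mul_smul_comm]

lemma commute_of_coeff {f g : MvPowerSeries σ R}
    (h : ∀ α β, Commute (MvPowerSeries.coeff α f) (MvPowerSeries.coeff β g)) : Commute f g := by
  classical
  ext α
  rw [MvPowerSeries.coeff_mul, MvPowerSeries.coeff_mul]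
  exact (sum_congr rfl fun β _ => h _ _).trans (Finsupp.sum_antidiagonal_swap α fun β γ =>
    MvPowerSeries.coeff γ g * MvPowerSeries.coeff β f)

lemma euler_pow {s : σ} {P : MvPowerSeries σ R} (h : Commute P (euler s P)) (p : ℕ) :
    euler s (P ^ (p + 1)) = (p + 1) • (euler s P * P ^ p) := by
  induction p with
  | zero => simp
  | succ p ih =>
    rw [pow_succ, euler_mul, ih, smul_mul_assoc, mul_assoc, ← pow_succ,
      (h.pow_left (p + 1)).eq, ← succ_nsmul]

/-- This makes the truncation in the exponential harmless: all later terms vanish in the given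
degree. -/
lemma coeff_pow_eq_zero {P : MvPowerSeries σ R} (hP : MvPowerSeries.coeff 0 P = 0) (p : ℕ)
    (α : σ →₀ ℕ) (h : α.degree < p) : MvPowerSeries.coeff α (P ^ p) = 0 := by
  classical
  induction p generalizing α with
  | zero => omega
  | succ p ih =>
    rw [pow_succ', MvPowerSeries.coeff_mul]
    refine sum_eq_zero fun β hβ => ?_
    rw [HasAntidiagonal.mem_antidiagonal] at hβ
    by_cases h0 : β.1 = 0
    · rw [h0, hP, zero_mul]
    · have h1 : β.1.degree ≠ 0 := fun h => h0 ((Finsupp.degree_eq_zero_iff _).1 h)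
      have h2 : β.1.degree + β.2.degree = α.degree := by rw [← hβ, map_add]
      rw [ih β.2 (by omega), mul_zero]

variable [Algebra ℂ R]

/-- The exponential of a power series with zero constant term. -/
def expOf (P : MvPowerSeries σ R) : MvPowerSeries σ R :=
  fun α => ∑ p ∈ range (α.degree + 1), ((p.factorial : ℂ)⁻¹) • MvPowerSeries.coeff α (P ^ p)

lemma coeff_expOf (P : MvPowerSeries σ R) (α : σ →₀ ℕ) : MvPowerSeries.coeff α (expOf P) =
    ∑ p ∈ range (α.degree + 1), ((p.factorial : ℂ)⁻¹) • MvPowerSeries.coeff α (P ^ p) := rfl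

lemma coeff_expOf_of_lt {P : MvPowerSeries σ R} (hP : MvPowerSeries.coeff 0 P = 0)
    {α : σ →₀ ℕ} {n : ℕ} (h : α.degree < n) : MvPowerSeries.coeff α (expOf P) =
    ∑ p ∈ range n, ((p.factorial : ℂ)⁻¹) • MvPowerSeries.coeff α (P ^ p) := by
  rw [coeff_expOf]
  refine sum_subset (range_mono (by omega)) fun p _ hp => ?_
  rw [mem_range] at hp
  rw [coeff_pow_eq_zero hP p α (by omega), smul_zero]

lemma coeff_zero_expOf (P : MvPowerSeries σ R) : MvPowerSeries.coeff 0 (expOf P) = 1 := by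
  rw [coeff_expOf]; simp

/-- The Euler operators act on exponentials as derivations. -/
lemma euler_expOf {s : σ} {P : MvPowerSeries σ R} (hP : MvPowerSeries.coeff 0 P = 0)
    (hc : ∀ α β, Commute (MvPowerSeries.coeff α P) (MvPowerSeries.coeff β P)) :
    euler s (expOf P) = euler s P * expOf P := by
  classical
  have h : Commute P (euler s P) := commute_of_coeff fun α β => by
    rw [coeff_euler]; exact (hc α β).smul_right _
  ext α
  -- One extra term is taken so that, once p = 0 is split off, the shifted index still runs up to
  -- the degree.
  rw [coeff_euler, coeff_expOf_of_lt hP (n := α.degree + 2) (by omega), sum_range_succ',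
    smul_add, smul_sum, MvPowerSeries.coeff_mul]
  have h0 : α s • ((Nat.factorial 0 : ℂ)⁻¹ • MvPowerSeries.coeff α (P ^ 0)) = 0 := by
    rw [pow_zero, MvPowerSeries.coeff_one]
    split_ifs with h
    · simp [h]
    · simp
  rw [h0, add_zero]
  have h1 : ∀ p ∈ range (α.degree + 1), α s • (((p + 1).factorial : ℂ)⁻¹ •
      MvPowerSeries.coeff α (P ^ (p + 1))) = ∑ β ∈ antidiagonal α,
        MvPowerSeries.coeff β.1 (euler s P) *
          ((p.factorial : ℂ)⁻¹ • MvPowerSeries.coeff β.2 (P ^ p)) := by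
    intro p _
    rw [smul_comm, ← coeff_euler, euler_pow h, map_nsmul, MvPowerSeries.coeff_mul,
      ← Nat.cast_smul_eq_nsmul ℂ, smul_smul, smul_sum]
    refine sum_congr rfl fun β _ => ?_
    rw [mul_smul_comm, Nat.factorial_succ]
    congr 1
    have : ((p + 1 : ℕ) : ℂ) ≠ 0 := by exact_mod_cast p.succ_ne_zero
    push_cast at this ⊢
    rw [mul_inv, mul_right_comm, inv_mul_cancel₀ this, one_mul]
  rw [sum_congr rfl h1, sum_comm]
  refine sum_congr rfl fun β hβ => ?_
  rw [HasAntidiagonal.mem_antidiagonal] at hβ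
  have h2 : β.1.degree + β.2.degree = α.degree := by rw [← hβ, map_add]
  rw [coeff_expOf_of_lt hP (n := α.degree + 1) (by omega), mul_sum]

/-- If a variable does not occur in P, it does not occur in the exponential. This separates x from y
in the tau function. -/
lemma coeff_expOf_eq_zero {P : MvPowerSeries σ R} {s : σ}
    (h : ∀ α, α s ≠ 0 → MvPowerSeries.coeff α P = 0) {α : σ →₀ ℕ} (hα : α s ≠ 0) :
    MvPowerSeries.coeff α (expOf P) = 0 := by
  classical
  have hp : ∀ (p : ℕ) (α : σ →₀ ℕ), α s ≠ 0 → MvPowerSeries.coeff α (P ^ p) = 0 := by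
    intro p
    induction p with
    | zero =>
      intro α hα
      rw [pow_zero, MvPowerSeries.coeff_one, if_neg]
      rintro rfl
      exact hα rfl
    | succ p ih =>
      intro α hα
      rw [pow_succ, MvPowerSeries.coeff_mul]
      refine sum_eq_zero fun β hβ => ?_
      rw [HasAntidiagonal.mem_antidiagonal] at hβ
      by_cases h1 : β.1 s = 0
      · rw [h β.2 fun h2 => hα (by rw [← hβ, Finsupp.add_apply, h1, h2]), mul_zero]
      · rw [ih _ h1, zero_mul]
  rw [coeff_expOf]
  exact sum_eq_zero fun p _ => by rw [hp p α hα, smul_zero]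

end Exponential

/-- An intertwiner of the exponents intertwines the exponentials. Every passage between different
families of operators, such as Bₘ and its image on Laurent series, goes through this. -/
lemma map_expOf {σ V W : Type*} [AddCommGroup V] [Module ℂ V] [AddCommGroup W] [Module ℂ W]
    (f : V →ₗ[ℂ] W) {P : MvPowerSeries σ (Module.End ℂ V)} {Q : MvPowerSeries σ (Module.End ℂ W)}
    (h : ∀ α v, f (MvPowerSeries.coeff α P v) = MvPowerSeries.coeff α Q (f v)) (α : σ →₀ ℕ)
    (v : V) : f (MvPowerSeries.coeff α (expOf P) v) = MvPowerSeries.coeff α (expOf Q) (f v) := by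
  classical
  have hp : ∀ (p : ℕ) (α : σ →₀ ℕ) (v : V),
      f (MvPowerSeries.coeff α (P ^ p) v) = MvPowerSeries.coeff α (Q ^ p) (f v) := by
    intro p
    induction p with
    | zero =>
      intro α v
      rw [pow_zero, pow_zero, MvPowerSeries.coeff_one, MvPowerSeries.coeff_one]
      split_ifs <;> simp
    | succ p ih =>
      intro α v
      rw [pow_succ, pow_succ, MvPowerSeries.coeff_mul, MvPowerSeries.coeff_mul,
        LinearMap.sum_apply, LinearMap.sum_apply, map_sum]
      exact sum_congr rfl fun β _ => by rw [Module.End.mul_apply, Module.End.mul_apply, ih, h]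
  rw [coeff_expOf, coeff_expOf, LinearMap.sum_apply, LinearMap.sum_apply, map_sum]
  exact sum_congr rfl fun p _ => by rw [LinearMap.smul_apply, LinearMap.smul_apply, map_smul, hp]

lemma expOf_adjoint {σ V W : Type*} [AddCommGroup V] [Module ℂ V] [AddCommGroup W] [Module ℂ W]
    (b : V →ₗ[ℂ] W →ₗ[ℂ] ℂ) {P : MvPowerSeries σ (Module.End ℂ V)}
    {Q : MvPowerSeries σ (Module.End ℂ W)}
    (h : ∀ α v w, b (MvPowerSeries.coeff α P v) w = b v (MvPowerSeries.coeff α Q w))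
    (α : σ →₀ ℕ) (v : V) (w : W) :
    b (MvPowerSeries.coeff α (expOf P) v) w = b v (MvPowerSeries.coeff α (expOf Q) w) := by
  classical
  have hp : ∀ (p : ℕ) (α : σ →₀ ℕ) (v : V) (w : W),
      b (MvPowerSeries.coeff α (P ^ p) v) w = b v (MvPowerSeries.coeff α (Q ^ p) w) := by
    intro p
    induction p with
    | zero =>
      intro α v w
      rw [pow_zero, pow_zero, MvPowerSeries.coeff_one, MvPowerSeries.coeff_one]
      split_ifs <;> simp
    | succ p ih =>
      intro α v w
      -- Taking adjoints reverses products, so the new factor is split off on opposite sides.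
      rw [pow_succ, pow_succ', MvPowerSeries.coeff_mul, MvPowerSeries.coeff_mul,
        LinearMap.sum_apply, LinearMap.sum_apply, map_sum, map_sum, LinearMap.sum_apply]
      refine (sum_congr rfl fun β _ => ?_).trans (Finsupp.sum_antidiagonal_swap α fun β γ =>
        b v ((MvPowerSeries.coeff γ Q * MvPowerSeries.coeff β (Q ^ p)) w))
      rw [Module.End.mul_apply, Module.End.mul_apply, ih, h]
  rw [coeff_expOf, coeff_expOf, LinearMap.sum_apply, LinearMap.sum_apply, map_sum, map_sum,
    LinearMap.sum_apply]
  exact sum_congr rfl fun p _ => by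
    rw [LinearMap.smul_apply, LinearMap.smul_apply, map_smul, map_smul, LinearMap.smul_apply, hp]

/-! ### The exponents `∑ t_m A_m` with `t_m` odd power sums -/

section Times

variable {σ R : Type} [Semiring R] [Algebra ℂ R]

/-- The power series `∑ t_m A_m`, with `m` running through the odd numbers. -/
def timesSumOf (t : ℕ → MvPowerSeries σ ℂ) (A : ℕ → R) : MvPowerSeries σ R :=
  fun α => ∑ᶠ m : {m : ℕ // Odd m}, MvPowerSeries.coeff α (t m) • A m

open Classical in
lemma coeff_powerTimes {n : ℕ} (z : Fin n → σ) {m : ℕ} (hm : Odd m) (α : σ →₀ ℕ) :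
    MvPowerSeries.coeff α (powerTimes (fun j => MvPowerSeries.X (z j)) m) =
      ∑ j, if α = Finsupp.single (z j) m then 2 / (m : ℂ) else 0 := by
  rw [powerTimes, MvPowerSeries.coeff_smul, map_sum, mul_sum]
  refine sum_congr rfl fun j _ => ?_
  rw [hm.neg_pow, sub_neg_eq_add, map_add, MvPowerSeries.coeff_X_pow]
  split_ifs
  · rw [div_eq_mul_inv]; ring
  · simp

lemma coeff_powerTimes_eq_zero {n : ℕ} (z : Fin n → σ) {m : ℕ} (hm : Odd m) {α : σ →₀ ℕ}
    (h : α.degree ≠ m) :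
    MvPowerSeries.coeff α (powerTimes (fun j => MvPowerSeries.X (z j)) m) = 0 := by
  classical
  rw [coeff_powerTimes z hm]
  refine sum_eq_zero fun j _ => if_neg ?_
  rintro rfl
  exact h (by simp)

/-- The time tₘ is homogeneous of degree m, so at most one m contributes to a given monomial. -/
lemma coeff_timesSumOf {n : ℕ} (z : Fin n → σ) (A : ℕ → R) (α : σ →₀ ℕ) :
    MvPowerSeries.coeff α (timesSumOf (powerTimes fun j => MvPowerSeries.X (z j)) A) =
      if Odd α.degree then
        MvPowerSeries.coeff α (powerTimes (fun j => MvPowerSeries.X (z j)) α.degree) • A α.degree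
      else 0 := by
  change (∑ᶠ m : {m : ℕ // Odd m}, _) = _
  split_ifs with h
  · rw [finsum_eq_single _ (⟨α.degree, h⟩ : {m : ℕ // Odd m})]
    rintro ⟨m, hm⟩ hne
    rw [coeff_powerTimes_eq_zero z hm fun e => hne (Subtype.ext e.symm), zero_smul]
  · refine finsum_eq_zero_of_forall_eq_zero ?_
    rintro ⟨m, hm⟩
    rw [coeff_powerTimes_eq_zero z hm (by rintro rfl; exact h hm), zero_smul]

lemma coeff_timesSumOf_eq_zero {n : ℕ} {z : Fin n → σ} (A : ℕ → R) {s : σ} (hs : ∀ j, z j ≠ s)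
    {α : σ →₀ ℕ} (hα : α s ≠ 0) :
    MvPowerSeries.coeff α (timesSumOf (powerTimes fun j => MvPowerSeries.X (z j)) A) = 0 := by
  classical
  rw [coeff_timesSumOf]
  split_ifs with h
  · rw [coeff_powerTimes z h, sum_eq_zero, zero_smul]
    intro j _
    refine if_neg fun e => hα ?_
    rw [e, Finsupp.single_apply, if_neg (hs j)]
  · rfl

lemma coeff_zero_timesSumOf {n : ℕ} (z : Fin n → σ) (A : ℕ → R) :
    MvPowerSeries.coeff 0 (timesSumOf (powerTimes fun j => MvPowerSeries.X (z j)) A) = 0 := by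
  rw [coeff_timesSumOf, if_neg (by simp)]

lemma commute_coeff_timesSumOf {n : ℕ} (z : Fin n → σ) {A : ℕ → R}
    (hA : ∀ m n, Odd m → Odd n → Commute (A m) (A n)) (α β : σ →₀ ℕ) :
    Commute
      (MvPowerSeries.coeff α (timesSumOf (powerTimes fun j => MvPowerSeries.X (z j)) A))
      (MvPowerSeries.coeff β (timesSumOf (powerTimes fun j => MvPowerSeries.X (z j)) A)) := by
  rw [coeff_timesSumOf, coeff_timesSumOf]
  split_ifs with h1 h2
  · exact ((hA _ _ h1 h2).smul_right _).smul_left _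
  all_goals simp

-- The Euler operator of one variable keeps only the powers of that variable and cancels the factor
-- 1/m, leaving 2∑ Aₖzᵏ over odd k.
open Classical in
lemma coeff_euler_timesSumOf {n : ℕ} {z : Fin n → σ} (hz : Function.Injective z) (A : ℕ → R)
    (j : Fin n) (α : σ →₀ ℕ) : MvPowerSeries.coeff α
      (euler (z j) (timesSumOf (powerTimes fun j => MvPowerSeries.X (z j)) A)) =
      if α = Finsupp.single (z j) (α (z j)) ∧ Odd (α (z j)) then (2 : ℂ) • A (α (z j)) else 0 := by
  rw [coeff_euler, coeff_timesSumOf]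
  by_cases h : α = Finsupp.single (z j) (α (z j))
  · have hd : α.degree = α (z j) := by
      conv_lhs => rw [h]
      simp
    rw [hd]
    by_cases ho : Odd (α (z j))
    · rw [if_pos ho, if_pos ⟨h, ho⟩, coeff_powerTimes z ho, sum_eq_single j, if_pos h,
        ← Nat.cast_smul_eq_nsmul ℂ, smul_smul, mul_div_cancel₀]
      · exact_mod_cast ho.pos.ne'
      · intro i _ hi
        refine if_neg fun e => ?_
        rw [h] at e
        have := congrArg (fun f => f (z j)) e
        simp only [Finsupp.single_eq_same] at this
        rw [Finsupp.single_apply, if_neg fun e => hi (hz e)] at this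
        rw [this] at ho
        exact absurd ho (by simp)
      · simp
    · rw [if_neg ho, if_neg fun h => ho h.2, smul_zero]
  · have hn : ¬(α = Finsupp.single (z j) (α (z j)) ∧ Odd (α (z j))) := fun h₁ => h h₁.1
    rw [if_neg hn]
    by_cases ho : Odd α.degree
    · rw [if_pos ho, coeff_powerTimes z ho, sum_smul, smul_sum]
      refine sum_eq_zero fun i _ => ?_
      split_ifs with e
      · have hij : z i ≠ z j := by
          intro hij
          apply h
          rw [hij] at e
          conv_lhs => rw [e]
          rw [e]; simp
        rw [e, Finsupp.single_apply, if_neg hij, zero_smul]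
      · rw [zero_smul, smul_zero]
    · rw [if_neg ho, smul_zero]

/-- The recursion for the coefficients of `exp (∑ t_m A_m)`. -/
theorem coeff_expOf_timesSumOf {n : ℕ} {z : Fin n → σ} (hz : Function.Injective z) {A : ℕ → R}
    (hA : ∀ m n, Odd m → Odd n → Commute (A m) (A n)) (j : Fin n) (α : σ →₀ ℕ) :
    α (z j) • MvPowerSeries.coeff α
        (expOf (timesSumOf (powerTimes fun j => MvPowerSeries.X (z j)) A)) =
      ∑ k ∈ range (α (z j) + 1), if Odd k then (2 : ℂ) • (A k * MvPowerSeries.coeff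
        (α - Finsupp.single (z j) k)
        (expOf (timesSumOf (powerTimes fun j => MvPowerSeries.X (z j)) A))) else 0 := by
  classical
  rw [← coeff_euler, euler_expOf (coeff_zero_timesSumOf z A) (commute_coeff_timesSumOf z hA),
    MvPowerSeries.coeff_mul]
  -- Only splittings of α whose first part is a power of the variable z j contribute to the
  -- convolution.
  refine (sum_of_injOn (fun k => (Finsupp.single (z j) k, α - Finsupp.single (z j) k))
    ?_ ?_ ?_ ?_).symm
  · intro k _ k' _ h
    simpa using congrArg (fun f => f.1 (z j)) h
  · intro k hk
    rw [coe_range, Set.mem_Iio] at hk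
    rw [mem_coe, HasAntidiagonal.mem_antidiagonal]
    refine add_tsub_cancel_of_le (Finsupp.single_le_iff.2 (by omega))
  · intro β hβ hn
    rw [HasAntidiagonal.mem_antidiagonal] at hβ
    rw [coeff_euler_timesSumOf hz, if_neg, zero_mul]
    rintro ⟨e, -⟩
    refine hn ⟨β.1 (z j), ?_, ?_⟩
    · rw [coe_range, Set.mem_Iio, ← hβ, Finsupp.add_apply]; omega
    · refine Prod.ext e.symm ?_
      dsimp only
      rw [← e, ← hβ, add_tsub_cancel_left]
  · intro k _
    rw [coeff_euler_timesSumOf hz]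
    simp only [Finsupp.single_eq_same, true_and]
    split_ifs
    · rw [smul_mul_assoc]
    · rw [zero_mul]

end Times

/-! ### The half vertex operator in one variable -/

/-- The series `exp (∑ t_m H_m)` in one variable, where `t_m = 2 x^m / m` for odd `m`. -/
def vertSeries : PowerSeries (Module.End ℂ Fock) :=
  expOf (timesSumOf (powerTimes fun _ : Fin 1 => MvPowerSeries.X ()) fun m => H m)

/-- The coefficients of the half vertex operator. -/
def vert (k : ℕ) : Module.End ℂ Fock := PowerSeries.coeff k vertSeries

lemma H_commute' (m n : ℕ) (hm : Odd m) (hn : Odd n) : Commute (H m) (H n) := H_commute hm hn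

lemma unit_injective : Function.Injective fun _ : Fin 1 => () :=
  fun _ _ _ => Subsingleton.elim _ _

lemma vert_zero : vert 0 = 1 := by
  rw [vert, PowerSeries.coeff_zero_eq_constantCoeff_apply]
  exact coeff_zero_expOf _

/-- The Euler operator on power series in one variable. -/
def eulerOne {R : Type*} [Semiring R] (f : PowerSeries R) : PowerSeries R := euler () f

lemma eulerOne_mul {R : Type*} [Semiring R] (f g : PowerSeries R) :
    eulerOne (f * g) = eulerOne f * g + f * eulerOne g := euler_mul _ _ _

lemma coeff_eulerOne {R : Type*} [Semiring R] (f : PowerSeries R) (k : ℕ) :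
    PowerSeries.coeff k (eulerOne f) = k • PowerSeries.coeff k f := by
  rw [PowerSeries.coeff, eulerOne, coeff_euler, Finsupp.single_eq_same]

/-- The series `2 ∑ H_m x^m`, with `m` running through the odd numbers. -/
def heisSeries : PowerSeries (Module.End ℂ Fock) :=
  PowerSeries.mk fun m => if Odd m then (2 : ℂ) • H m else 0

lemma euler_vertSeries : eulerOne vertSeries = heisSeries * vertSeries := by
  rw [vertSeries, eulerOne, euler_expOf (coeff_zero_timesSumOf _ _) (commute_coeff_timesSumOf _ H_commute')]
  congr 1
  refine PowerSeries.ext fun k => ?_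
  rw [heisSeries, PowerSeries.coeff_mk]
  refine (coeff_euler_timesSumOf unit_injective _ 0 _).trans ?_
  simp

/-- The solution of `x dY/dx = h Y` is determined by its constant term. -/
lemma eq_of_euler_eq {R : Type*} [Semiring R] [Algebra ℂ R] {h Y Z : PowerSeries R}
    (hh : PowerSeries.coeff 0 h = 0) (hY : eulerOne Y = h * Y) (hZ : eulerOne Z = h * Z)
    (h0 : PowerSeries.coeff 0 Y = PowerSeries.coeff 0 Z) : Y = Z := by
  refine PowerSeries.ext fun k => ?_
  induction k using Nat.strong_induction_on with
  | _ k ih =>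
    rcases Nat.eq_zero_or_pos k with rfl | hk
    · exact h0
    · have hk' : (k : ℂ) ≠ 0 := by exact_mod_cast hk.ne'
      have e : k • PowerSeries.coeff k Y = k • PowerSeries.coeff k Z := by
        rw [← coeff_eulerOne, ← coeff_eulerOne, hY, hZ, PowerSeries.coeff_mul,
          PowerSeries.coeff_mul]
        refine sum_congr rfl fun p hp => ?_
        rw [HasAntidiagonal.mem_antidiagonal] at hp
        by_cases h1 : p.1 = 0
        · rw [h1, hh, zero_mul, zero_mul]
        · rw [ih p.2 (by omega)]
      rw [← Nat.cast_smul_eq_nsmul ℂ, ← Nat.cast_smul_eq_nsmul ℂ] at e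
      exact smul_right_injective _ hk' e

/-- The coefficients of `(1 + x) / (1 - x)`. -/
def qc (j : ℕ) : ℂ := if j = 0 then 1 else 2

/-- In coefficients: q = (1 + x)/(1 - x) satisfies x q' = q · 2(x + x³ + x⁵ + ⋯). The induction goes
in steps of two because the parity condition has period two. -/
lemma sum_qc (s : ℕ) :
    ∑ j ∈ range (s + 1), qc j * (if Odd (s - j) then 2 else 0) = s * qc s := by
  induction s using Nat.twoStepInduction with
  | zero => simp
  | one => simp [sum_range_succ, qc]
  | more s ih _ =>
    rw [sum_range_succ, sum_range_succ]
    have : ∀ j ∈ range (s + 1), qc j * (if Odd (s + 2 - j) then (2 : ℂ) else 0) =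
        qc j * (if Odd (s - j) then 2 else 0) := by
      intro j hj
      rw [mem_range] at hj
      rw [show s + 2 - j = s - j + 2 by omega]
      simp [Nat.odd_add, parity_simps]
    rw [sum_congr rfl this, ih, show s + 2 - (s + 1) = 1 by omega, Nat.sub_self,
      if_pos odd_one, if_neg (by simp)]
    rcases Nat.eq_zero_or_pos s with rfl | hs
    · norm_num [qc]
    · simp [qc, hs.ne']; ring

/-- The half vertex operator moved past a fermion. -/
lemma vertSeries_mul_phi (n : ℤ) : vertSeries * PowerSeries.C (phi n) =
    PowerSeries.mk (fun j => qc j • phi (n - j)) * vertSeries := by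
  have hC : eulerOne (PowerSeries.C (phi n)) = 0 := by
    refine PowerSeries.ext fun k => ?_
    rw [coeff_eulerOne, PowerSeries.coeff_C]
    split_ifs with h <;> simp [h]
  -- With this relation both sides of the claim solve the same equation x dY/dx = hY, and both have
  -- constant term φₙ.
  have hF : eulerOne (PowerSeries.mk fun j => qc j • phi (n - j)) +
      PowerSeries.mk (fun j => qc j • phi (n - j)) * heisSeries =
      heisSeries * PowerSeries.mk (fun j => qc j • phi (n - j)) := by
    refine PowerSeries.ext fun k => ?_
    rw [map_add, coeff_eulerOne, PowerSeries.coeff_mk, PowerSeries.coeff_mul,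
      PowerSeries.coeff_mul, ← Nat.sum_antidiagonal_swap
        (f := fun p => PowerSeries.coeff p.1 heisSeries * PowerSeries.coeff p.2 _)]
    have : ∀ p ∈ antidiagonal k, PowerSeries.coeff p.swap.1 heisSeries *
        PowerSeries.coeff p.swap.2 (PowerSeries.mk fun j => qc j • phi (n - j)) =
        (qc p.1 * (if Odd p.2 then 2 else 0)) • phi (n - k) +
        PowerSeries.coeff p.1 (PowerSeries.mk fun j => qc j • phi (n - j)) *
        PowerSeries.coeff p.2 heisSeries := by
      intro p hp
      rw [HasAntidiagonal.mem_antidiagonal] at hp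
      rw [heisSeries, Prod.fst_swap, Prod.snd_swap, PowerSeries.coeff_mk, PowerSeries.coeff_mk,
        ← hp]
      split_ifs with ho
      · have e : H p.2 * phi (n - p.1) = phi (n - (p.1 + p.2 : ℕ)) + phi (n - p.1) * H p.2 := by
          refine LinearMap.ext fun v => ?_
          rw [LinearMap.add_apply, Module.End.mul_apply, Module.End.mul_apply, H_phi ho,
            add_comm]
          push_cast
          rw [sub_sub]
        rw [smul_mul_smul_comm, e, smul_mul_smul_comm, smul_add, mul_comm (2 : ℂ)]
      · simp
    rw [sum_congr rfl this, sum_add_distrib, ← sum_smul,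
      Nat.sum_antidiagonal_eq_sum_range_succ fun i j => qc i * (if Odd j then (2 : ℂ) else 0),
      sum_qc, mul_smul, Nat.cast_smul_eq_nsmul]
  refine eq_of_euler_eq (h := heisSeries) ?_ ?_ ?_ ?_
  · rw [heisSeries, PowerSeries.coeff_mk]; simp
  · rw [eulerOne_mul, hC, mul_zero, add_zero, euler_vertSeries, mul_assoc]
  · rw [eulerOne_mul, euler_vertSeries, ← mul_assoc, ← add_mul, hF, mul_assoc]
  · have := vert_zero
    rw [vert] at this
    rw [PowerSeries.coeff_mul, PowerSeries.coeff_mul]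
    simp [qc, this, -PowerSeries.coeff_zero_eq_constantCoeff]

lemma vert_mul_phi (k : ℕ) (n : ℤ) : vert k * phi n =
    ∑ j ∈ range (k + 1), qc j • (phi (n - j) * vert (k - j)) := by
  have := congrArg (PowerSeries.coeff k) (vertSeries_mul_phi n)
  rw [PowerSeries.coeff_mul_C, PowerSeries.coeff_mul,
    Nat.sum_antidiagonal_eq_sum_range_succ fun i j => PowerSeries.coeff i
      (PowerSeries.mk fun j => qc j • phi (n - j)) * PowerSeries.coeff j vertSeries] at this
  rw [vert, this]
  simp only [PowerSeries.coeff_mk, smul_mul_assoc, vert]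

lemma add_sum_qc {V : Type*} [AddCommMonoid V] [Module ℂ V] (X : ℕ → V) (k : ℕ) :
    X 0 + ∑ j ∈ range (k + 1), qc j • X j = ∑ j ∈ range (k + 1), qc (j + 1) • X j := by
  rw [sum_range_succ', sum_range_succ']
  simp only [qc, if_true, Nat.succ_ne_zero, if_false, one_smul, two_smul]
  abel

/-- The relation of `vert_mul_phi` with the denominator of (1 + x)/(1 - x) cleared, which leaves
finitely many terms independent of k. -/
lemma vert_succ_mul_phi (k : ℕ) (n : ℤ) : vert (k + 1) * phi n =
    phi n * vert (k + 1) + phi (n - 1) * vert k + vert k * phi (n - 1) := by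
  have h := add_sum_qc (fun j => phi (n - 1 - j) * vert (k - j)) k
  rw [← vert_mul_phi, Nat.cast_zero, sub_zero, Nat.sub_zero] at h
  rw [vert_mul_phi, sum_range_succ', add_assoc, h, add_comm]
  refine congrArg₂ (· + ·) ?_ ?_
  · rw [qc, if_pos rfl, one_smul, Nat.cast_zero, sub_zero, Nat.sub_zero]
  · refine sum_congr rfl fun j _ => ?_
    rw [Nat.add_sub_add_right, Nat.cast_succ, show n - ((j : ℤ) + 1) = n - 1 - j by ring]

lemma vert_commute_H {m : ℕ} (hm : Odd m) (k : ℕ) : H m * vert k = vert k * H m := by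
  refine LinearMap.ext fun v => ?_
  refine map_expOf (H m) (fun α w => ?_) (Finsupp.single () k) v
  rw [coeff_timesSumOf (fun _ : Fin 1 => ())]
  split_ifs with ho
  · have := LinearMap.congr_fun (H_commute hm ho) w
    simp only [Module.End.mul_apply] at this
    rw [LinearMap.smul_apply, LinearMap.smul_apply, map_smul, this]
  · simp

lemma nsmul_vert (k : ℕ) : k • vert k =
    ∑ i ∈ range (k + 1), if Odd i then (2 : ℂ) • (H i * vert (k - i)) else 0 := by
  rw [vert, ← coeff_eulerOne, euler_vertSeries, PowerSeries.coeff_mul,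
    Nat.sum_antidiagonal_eq_sum_range_succ fun i j => PowerSeries.coeff i heisSeries *
      PowerSeries.coeff j vertSeries]
  refine sum_congr rfl fun i _ => ?_
  rw [heisSeries, PowerSeries.coeff_mk]
  split_ifs
  · rw [smul_mul_assoc]; rfl
  · rw [zero_mul]

/-- By the recursion, k · `vert k` is a combination of products in which some Hₘ can be moved to the
right. It is needed for both |0⟩ and φ₀|0⟩. -/
lemma vert_apply_eq_zero {k : ℕ} (hk : k ≠ 0) {v : Fock} (hv : ∀ m : ℕ, Odd m → H m v = 0) :
    vert k v = 0 := by
  have h := LinearMap.congr_fun (nsmul_vert k) v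
  rw [LinearMap.sum_apply, sum_eq_zero, ← Nat.cast_smul_eq_nsmul ℂ, LinearMap.smul_apply] at h
  · exact (smul_eq_zero.1 h).resolve_left (by exact_mod_cast hk)
  · intro i _
    split_ifs with ho
    · rw [vert_commute_H ho, LinearMap.smul_apply, Module.End.mul_apply, hv i ho, map_zero,
        smul_zero]
    · rfl

lemma vert_vacuum {k : ℕ} (hk : k ≠ 0) : vert k vacuum = 0 :=
  vert_apply_eq_zero hk fun _ hm => H_vacuum hm

lemma lam_phi_neg_phi {n : ℤ} (hn : 0 < n) (k : ℕ) (w : Fock) :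
    rt * (-1) ^ k * lam (phi (-k) (phi n w)) = if (k : ℤ) = n then rt * lam w else 0 := by
  rw [phi_phi_apply, map_sub, lam_phi hn, sub_zero]
  simp only [neg_inj]
  split_ifs with h
  · rw [map_smul, ← h, zpow_natCast, smul_eq_mul]
    have : (-1 : ℂ) ^ k * (-1) ^ k = 1 := by rw [← mul_pow]; norm_num
    linear_combination rt * lam w * this
  · simp

/-- On the functional `⟨0| + √2 ⟨0| φ₀` the half vertex operator acts as a fermion. -/
lemma lam_vert (k : ℕ) (v : Fock) : lam (vert k v) = rt * (-1) ^ k * lam (phi (-k) v) := by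
  induction k generalizing v with
  | zero => simp [vert_zero, rt_mul_lam_phi_zero]
  | succ k ih =>
    suffices lam ∘ₗ vert (k + 1) = (rt * (-1) ^ (k + 1)) • (lam ∘ₗ phi (-(k + 1 : ℕ))) from
      LinearMap.congr_fun this v
    refine end_ext fun S => ?_
    rw [LinearMap.smul_apply, LinearMap.comp_apply, LinearMap.comp_apply, smul_eq_mul]
    -- This serves to write the basis vector as φₐw with a its largest index. The terms with λ next
    -- to a fermion of positive index then drop out, and the cases a = 0 and a = 1 are special.
    induction S using Finset.induction_on_max with
    | empty =>
      change lam (vert (k + 1) vacuum) = _ * lam (phi _ vacuum)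
      rw [vert_vacuum k.succ_ne_zero, phi_vacuum (by omega)]; simp
    | insert a S ha ih' =>
      rw [← phi_single_of_lt ha]
      rcases Nat.eq_zero_or_pos a with rfl | hpos
      · obtain rfl : S = ∅ := eq_empty_of_forall_notMem fun x hx => absurd (ha x hx) (by omega)
        change lam (vert (k + 1) (phi _ vacuum)) = _ * lam (phi _ (phi _ vacuum))
        rw [vert_apply_eq_zero k.succ_ne_zero, phi_phi_apply, if_neg (by omega),
          phi_vacuum (by omega)]
        · simp
        · intro m hm
          have := hm.pos
          rw [H_phi hm, H_vacuum hm, phi_vacuum (by omega)]; simp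
      · generalize Finsupp.single S (1 : ℂ) = w
        rw [lam_phi_neg_phi (by omega)]
        have h := congrArg lam (LinearMap.congr_fun (vert_succ_mul_phi k a) w)
        simp only [LinearMap.add_apply, Module.End.mul_apply, map_add] at h
        rw [h, lam_phi (by omega), zero_add, ih]
        rcases Nat.lt_or_ge 1 a with h1 | h1
        · rw [lam_phi (by omega), lam_phi_neg_phi (by omega), zero_add]
          congr 1
          simp only [eq_iff_iff]
          omega
        -- Here φₐ₋₁ = φ₀ does not kill λ, and √2λφ₀ = λ has to be used.
        · obtain rfl : a = 1 := by omega
          rw [Nat.cast_one, sub_self, phi_phi_apply, zpow_zero, one_smul, map_sub]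
          have e1 := rt_mul_lam_phi_zero (phi (-k) w)
          have e2 := rt_mul_lam_phi_zero (vert k w)
          rw [ih] at e2
          have e3 := mul_left_cancel₀ rt_ne_zero (e2.trans (mul_assoc _ _ _))
          rw [e3]
          rcases Nat.eq_zero_or_pos k with rfl | hk
          · rw [Nat.cast_zero, neg_zero] at e1
            simp
            linear_combination -e1
          · rw [if_neg (by omega), if_neg (by omega)]
            rw [map_zero]
            linear_combination (-(-1) ^ k) * e1

/-! ### The half vertex operator in several variables -/

/-- The product of the coefficients of half vertex operators in several variables. -/
def vertProd {ι σ : Type*} (z : ι → σ) (l : List ι) (α : σ →₀ ℕ) : Module.End ℂ Fock :=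
  (l.map fun i => vert (α (z i))).prod

lemma vertProd_cons {ι σ : Type*} (z : ι → σ) (i : ι) (l : List ι) (α : σ →₀ ℕ) :
    vertProd z (i :: l) α = vert (α (z i)) * vertProd z l α := by
  simp [vertProd]

lemma vertProd_sub {ι σ : Type*} {z : ι → σ} (hz : Function.Injective z) {j : ι} {l : List ι}
    (hj : j ∉ l) (α : σ →₀ ℕ) (k : ℕ) :
    vertProd z l (α - Finsupp.single (z j) k) = vertProd z l α := by
  classical
  unfold vertProd
  congr 1
  refine List.map_congr_left fun i hi => ?_
  rw [Finsupp.tsub_apply, Finsupp.single_apply, if_neg, Nat.sub_zero]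
  intro h
  exact hj (hz h ▸ hi)

/-- The product obeys the recursion of `coeff_expOf_timesSumOf`, and this recursion determines the
coefficients by induction on the degree. -/
lemma nsmul_vertProd {ι σ : Type*} {z : ι → σ} (hz : Function.Injective z) {j : ι} {l : List ι}
    (hl : l.Nodup) (hj : j ∈ l) (α : σ →₀ ℕ) : α (z j) • vertProd z l α =
      ∑ k ∈ range (α (z j) + 1), if Odd k then
        (2 : ℂ) • (H k * vertProd z l (α - Finsupp.single (z j) k)) else 0 := by
  classical
  induction l with
  | nil => simp at hj
  | cons i l ih =>
    rw [List.nodup_cons] at hl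
    by_cases hij : j = i
    · subst hij
      rw [vertProd_cons, ← smul_mul_assoc, nsmul_vert, sum_mul]
      refine sum_congr rfl fun k _ => ?_
      split_ifs
      · rw [vertProd_cons, vertProd_sub hz hl.1, Finsupp.tsub_apply, Finsupp.single_eq_same,
          smul_mul_assoc, mul_assoc]
      · rw [zero_mul]
    · have hjl : j ∈ l := (List.mem_cons.1 hj).resolve_left hij
      rw [vertProd_cons, ← mul_smul_comm, ih hl.2 hjl, mul_sum]
      refine sum_congr rfl fun k _ => ?_
      split_ifs with hk
      · rw [vertProd_cons, Finsupp.tsub_apply, Finsupp.single_apply,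
          if_neg fun h => hij (hz h), Nat.sub_zero, mul_smul_comm, ← mul_assoc, ← mul_assoc,
          vert_commute_H hk]
      · rw [mul_zero]

/-- The coefficients of `exp (∑ t_m H_m)` are products of those in one variable. -/
theorem coeff_exp_H {σ : Type} {n : ℕ} {z : Fin n → σ} (hz : Function.Injective z) (α : σ →₀ ℕ)
    (hα : ∀ s, s ∉ Set.range z → α s = 0) : MvPowerSeries.coeff α
      (expOf (timesSumOf (powerTimes fun j => MvPowerSeries.X (z j)) fun m => H m)) =
      vertProd z (List.finRange n) α := by
  induction hd : α.degree using Nat.strong_induction_on generalizing α with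
  | _ d ih =>
    by_cases h0 : α = 0
    · rw [h0, coeff_zero_expOf, vertProd]
      simp [vert_zero]
    · obtain ⟨s, hs⟩ := Finsupp.ne_iff.1 h0
      obtain ⟨j, rfl⟩ : s ∈ Set.range z := by
        by_contra h
        exact hs (hα s h)
      have hs' : ((α (z j) : ℕ) : ℂ) ≠ 0 := by exact_mod_cast hs
      have e : α (z j) • MvPowerSeries.coeff α
          (expOf (timesSumOf (powerTimes fun j => MvPowerSeries.X (z j)) fun m => H m)) =
          α (z j) • vertProd z (List.finRange n) α := by
        rw [coeff_expOf_timesSumOf hz H_commute' j α,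
          nsmul_vertProd hz (List.nodup_finRange n) (List.mem_finRange j)]
        refine sum_congr rfl fun k hk => ?_
        rw [mem_range] at hk
        split_ifs with ho
        · have hle : Finsupp.single (z j) k ≤ α := Finsupp.single_le_iff.2 (by omega)
          rw [ih _ _ (α - Finsupp.single (z j) k) _ rfl]
          · have := congrArg Finsupp.degree (tsub_add_cancel_of_le hle)
            rw [map_add, Finsupp.degree_single] at this
            have := ho.pos
            omega
          · intro s hs
            rw [Finsupp.tsub_apply, hα s hs, Nat.zero_sub]
        · rfl
      rw [← Nat.cast_smul_eq_nsmul ℂ, ← Nat.cast_smul_eq_nsmul ℂ] at e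
      exact smul_right_injective _ hs' e

/-! ### Reordering words -/

section Words

variable {ι : Type*}

/-- The coefficients of the half vertex operator, extended by zero to negative exponents. -/
def vertInt (a : ℤ) : Module.End ℂ Fock := if 0 ≤ a then vert a.toNat else 0

/-- The fermion `√2 φ(-1/x)`, as a series in `x`. -/
def ferm (a : ℤ) : Module.End ℂ Fock := (rt * (-1) ^ a) • phi (-a)

/-- The coefficient of x_iᵃx_jᵏ in (x_i + x_j)V(x_j)Φ(x_i) = (x_i - x_j)Φ(x_i)V(x_j). -/
lemma vertInt_mul_ferm (a k : ℤ) (v : Fock) :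
    vertInt k (ferm (a - 1) v) + vertInt (k - 1) (ferm a v) =
      ferm (a - 1) (vertInt k v) - ferm a (vertInt (k - 1) v) := by
  have e : (-1 : ℂ) ^ a = -(-1) ^ (a - 1) := by
    rw [zpow_sub_one₀ (by norm_num)]; norm_num
  have hn : -(a - 1) - 1 = -a := by ring
  simp only [ferm, e, LinearMap.smul_apply, map_smul]
  rcases lt_or_ge k 0 with hk | hk
  · rw [vertInt, if_neg hk.not_ge, vertInt, if_neg (by omega)]; simp
  · obtain ⟨k, rfl⟩ := Int.eq_ofNat_of_zero_le hk
    rcases k with _ | k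
    · simp [vertInt, vert_zero]
    · have h := LinearMap.congr_fun (vert_succ_mul_phi k (-(a - 1))) v
      simp only [LinearMap.add_apply, Module.End.mul_apply, hn] at h
      have h1 : vertInt ((k + 1 : ℕ) : ℤ) = vert (k + 1) := by
        rw [vertInt, if_pos (by omega), Int.toNat_natCast]
      have h2 : vertInt (((k + 1 : ℕ) : ℤ) - 1) = vert k := by
        rw [vertInt, if_pos (by omega)]
        congr 1
        omega
      rw [h1, h2, h]
      module

lemma lam_vertInt (k : ℤ) (v : Fock) : lam (vertInt k v) = lam (ferm k v) := by
  rw [ferm, LinearMap.smul_apply, map_smul, smul_eq_mul]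
  rcases lt_or_ge k 0 with hk | hk
  · rw [lam_phi (by omega)]
    simp [vertInt, hk.not_ge]
  · obtain ⟨k, rfl⟩ := Int.eq_ofNat_of_zero_le hk
    rw [vertInt, if_pos (by omega), Int.toNat_natCast, lam_vert, zpow_natCast]

/-- Words in the coefficients of the half vertex operators. -/
def vertWord : List ι → (ι → ℤ) → Fock → Fock
  | [], _, v => v
  | i :: l, a, v => vertInt (a i) (vertWord l a v)

/-- Words in the fermions, in the order opposite to that of the list. -/
def fermWord : List ι → (ι → ℤ) → Fock → Fock
  | [], _, v => v
  | i :: l, a, v => fermWord l a (ferm (a i) v)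

/-- The function `f` does not depend on the coordinate `s`. -/
def Indep {γ : Type*} (f : (ι → ℤ) → γ) (s : ι) : Prop :=
  ∀ a b : ι → ℤ, (∀ k, k ≠ s → a k = b k) → f a = f b

lemma vertWord_congr {l : List ι} {a b : ι → ℤ} (h : ∀ i ∈ l, a i = b i) (v : Fock) :
    vertWord l a v = vertWord l b v := by
  induction l with
  | nil => rfl
  | cons i l ih =>
    rw [vertWord, vertWord, ih fun j hj => h j (List.mem_cons_of_mem _ hj), h i List.mem_cons_self]

lemma Indep.vertWord {l : List ι} {s : ι} (hs : s ∉ l) {T : (ι → ℤ) → Fock} (hT : Indep T s) :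
    Indep (fun a => vertWord l a (T a)) s := fun a b h => by
  dsimp only
  rw [hT a b h, vertWord_congr fun i hi => h i fun e => hs (e ▸ hi)]

/-- The product of `f i j` over the pairs of elements of a list, `i` preceding `j`. -/
def pairProd {R : Type*} [Monoid R] (f : ι → ι → R) : List ι → R
  | [] => 1
  | i :: l => (l.map (f i)).prod * pairProd f l

lemma commute_map_prod {R : Type*} [Monoid R] {x : R} {f : ι → R} (h : ∀ j, Commute x (f j))
    (l : List ι) : Commute x (l.map f).prod :=
  Commute.list_prod_right _ _ fun y hy => by
    obtain ⟨j, -, rfl⟩ := List.mem_map.1 hy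
    exact h j

lemma commute_pairProd {R : Type*} [Monoid R] {x : R} {f : ι → ι → R}
    (h : ∀ i j, Commute x (f i j)) (l : List ι) : Commute x (pairProd f l) := by
  induction l with
  | nil => exact Commute.one_right x
  | cons i l ih => exact (commute_map_prod (h i) l).mul_right ih

variable [DecidableEq ι]

/-- Multiplication by the variable `x_i` on formal sums of Laurent monomials. -/
def shift (i : ι) : Module.End ℂ ((ι → ℤ) → ℂ) where
  toFun f a := f (a - Pi.single i 1)
  map_add' _ _ := rfl
  map_smul' _ _ := rfl

lemma shift_apply (i : ι) (f : (ι → ℤ) → ℂ) (a : ι → ℤ) :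
    shift i f a = f (a - Pi.single i 1) := rfl

lemma shift_commute (i j : ι) : Commute (shift i) (shift j) := by
  refine LinearMap.ext fun f => funext fun a => ?_
  rw [Module.End.mul_apply, Module.End.mul_apply]
  simp only [shift_apply, sub_right_comm]

/-- Independence of the surrounding factors from the two exponents lets the shifts act on the two
letters alone. -/
lemma swap_letters {i j : ι} (hij : i ≠ j) {A : (ι → ℤ) → Fock →ₗ[ℂ] ℂ} {T : (ι → ℤ) → Fock}
    (hAi : Indep A i) (hAj : Indep A j) (hTi : Indep T i) (hTj : Indep T j) :
    (shift i + shift j) (fun a => A a (vertInt (a j) (ferm (a i) (T a)))) =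
      (shift i - shift j) (fun a => A a (ferm (a i) (vertInt (a j) (T a)))) := by
  funext a
  rw [LinearMap.add_apply, LinearMap.sub_apply, Pi.add_apply, Pi.sub_apply]
  simp only [shift_apply]
  have h : ∀ s k : ι, k ≠ s → (a - Pi.single s 1 : ι → ℤ) k = a k := fun s k hk => by
    rw [Pi.sub_apply, Pi.single_eq_of_ne hk, sub_zero]
  have hs : ∀ s, (a - Pi.single s 1 : ι → ℤ) s = a s - 1 := fun s => by
    rw [Pi.sub_apply, Pi.single_eq_same]
  rw [hAi _ a (h i), hAj _ a (h j), hTi _ a (h i), hTj _ a (h j), h i j hij.symm, h j i hij,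
    hs, hs, ← map_add, ← map_sub, vertInt_mul_ferm]

lemma shift_add_commute_sub (i j k l : ι) :
    Commute (shift i + shift j) (shift k - shift l) :=
  ((shift_commute i k).sub_right (shift_commute i l)).add_left
    ((shift_commute j k).sub_right (shift_commute j l))

lemma shift_sub_commute_sub (i j k l : ι) :
    Commute (shift i - shift j) (shift k - shift l) :=
  ((shift_commute i k).sub_right (shift_commute i l)).sub_left
    ((shift_commute j k).sub_right (shift_commute j l))

lemma move_ferm {i : ι} {l : List ι} (hi : i ∉ l) (hl : l.Nodup) {A : (ι → ℤ) → Fock →ₗ[ℂ] ℂ}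
    {T : (ι → ℤ) → Fock} (hAi : Indep A i) (hA : ∀ j ∈ l, Indep A j)
    (hTi : Indep T i) (hT : ∀ j ∈ l, Indep T j) :
    (l.map fun j => shift i + shift j).prod
        (fun a => A a (vertWord l a (ferm (a i) (T a)))) =
      (l.map fun j => shift i - shift j).prod
        (fun a => A a (ferm (a i) (vertWord l a (T a)))) := by
  induction l generalizing A with
  | nil => rfl
  | cons j l ih =>
    rw [List.mem_cons, not_or] at hi
    rw [List.nodup_cons] at hl
    have hAj := hA j List.mem_cons_self
    have hTj := hT j List.mem_cons_self
    have key := ih hi.2 hl.2 (A := fun a => A a ∘ₗ vertInt (a j))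
      (fun a b h => by dsimp only; rw [hAi a b h, h j (Ne.symm hi.1)])
      (fun k hk a b h => by
        dsimp only
        rw [hA k (List.mem_cons_of_mem _ hk) a b h, h j fun e => hl.1 (e ▸ hk)])
      (fun k hk => hT k (List.mem_cons_of_mem _ hk))
    have sw := swap_letters hi.1 hAi hAj (hTi.vertWord hi.2) (hTj.vertWord hl.1)
    have hc : Commute (shift i + shift j) (l.map fun k => shift i - shift k).prod :=
      commute_map_prod (fun k => shift_add_commute_sub i j i k) l
    have hc' : Commute (shift i - shift j) (l.map fun k => shift i - shift k).prod :=
      commute_map_prod (fun k => shift_sub_commute_sub i j i k) l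
    rw [List.map_cons, List.prod_cons, List.map_cons, List.prod_cons, Module.End.mul_apply]
    refine (congrArg _ key).trans ?_
    rw [← Module.End.mul_apply, hc.eq, hc'.eq, Module.End.mul_apply, Module.End.mul_apply]
    exact congrArg _ sw

/-- The half vertex operators on the functional `⟨0| + √2 ⟨0| φ₀` expressed by fermions. -/
theorem lam_vertWord {l : List ι} (hl : l.Nodup) {T : (ι → ℤ) → Fock}
    (hT : ∀ j ∈ l, Indep T j) :
    pairProd (fun i j => shift i + shift j) l (fun a => lam (fermWord l a (T a))) =
      pairProd (fun i j => shift i - shift j) l (fun a => lam (vertWord l a (T a))) := by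
  induction l generalizing T with
  | nil => rfl
  | cons i l ih =>
    rw [List.nodup_cons] at hl
    have hTi := hT i List.mem_cons_self
    have hTl : ∀ j ∈ l, Indep T j := fun j hj => hT j (List.mem_cons_of_mem _ hj)
    have h1 := ih hl.2 (T := fun a => ferm (a i) (T a)) fun j hj a b h => by
      dsimp only
      rw [hTl j hj a b h, h i fun e => hl.1 (e ▸ hj)]
    have h2 := move_ferm hl.1 hl.2 (A := fun _ => lam) (T := T) (fun _ _ _ => rfl)
      (fun _ _ _ _ _ => rfl) hTi hTl
    -- Next to λ the first vertex operator becomes a fermion. By `move_ferm` it travels to the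
    -- innermost place, and the induction hypothesis treats the rest.
    have h3 : (fun a => lam (vertWord (i :: l) a (T a))) =
        fun a => lam (ferm (a i) (vertWord l a (T a))) :=
      funext fun a => by rw [vertWord, lam_vertInt]
    have hc : Commute (l.map fun j => shift i + shift j).prod
        (pairProd (fun i j => shift i - shift j) l) :=
      commute_pairProd (fun k m => (commute_map_prod
        (fun j => (shift_add_commute_sub i j k m).symm) l).symm) l
    have hc' : Commute (l.map fun j => shift i - shift j).prod
        (pairProd (fun i j => shift i - shift j) l) :=
      commute_pairProd (fun k m => (commute_map_prod
        (fun j => (shift_sub_commute_sub i j k m).symm) l).symm) l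
    rw [pairProd, pairProd, h3, Module.End.mul_apply]
    refine (congrArg _ h1).trans ?_
    rw [← Module.End.mul_apply, hc.eq, hc'.eq, Module.End.mul_apply, Module.End.mul_apply]
    exact congrArg _ h2

end Words

/-! ### Laurent series as functions of the exponents -/

variable {N : ℕ}

/-- The exponent with given coordinates. -/
def mkExpo (a : Fin N → ℤ) : Expo N := toLex fun i => a (OrderDual.ofDual i)

/-- The coefficients of a Laurent series as a function on `ℤ^N`. -/
def coeffFun : Laurent N →ₗ[ℂ] ((Fin N → ℤ) → ℂ) where
  toFun F a := F.coeff (mkExpo a)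
  map_add' _ _ := rfl
  map_smul' _ _ := rfl

lemma coeffFun_apply (F : Laurent N) (a : Fin N → ℤ) : coeffFun F a = F.coeff (mkExpo a) := rfl

lemma coeffFun_injective : Function.Injective (coeffFun (N := N)) := fun _ _ h =>
  HahnSeries.ext (funext fun e => congrFun h (expo e))

lemma coeffFun_xvar_mul (i : Fin N) (F : Laurent N) :
    coeffFun (xvar i * F) = shift i (coeffFun F) := by
  funext a
  rw [shift_apply, coeffFun_apply, coeffFun_apply]
  have : mkExpo a = mkExpo (a - Pi.single i 1) + toLex (Pi.single (OrderDual.toDual i) 1) := by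
    funext j
    change a (OrderDual.ofDual j) = (a - Pi.single i 1 : Fin N → ℤ) (OrderDual.ofDual j) +
      (Pi.single (OrderDual.toDual i) 1 : (Fin N)ᵒᵈ → ℤ) j
    rw [Pi.sub_apply, Pi.single_apply, Pi.single_apply]
    have : OrderDual.ofDual j = i ↔ j = OrderDual.toDual i := Iff.rfl
    simp only [this]
    ring
  rw [this, xvar, HahnSeries.coeff_single_mul_add, one_mul]

lemma xvar_add_xvar_ne_zero {i j : Fin N} (h : i ≠ j) : xvar i + xvar j ≠ 0 := by
  intro e
  have := congrArg (fun F => HahnSeries.coeff F (toLex (Pi.single (OrderDual.toDual i) 1))) e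
  have hne : (toLex (Pi.single (OrderDual.toDual i) 1) : Expo N) ≠
      toLex (Pi.single (OrderDual.toDual j) 1) := by
    intro e
    have := congrFun (toLex.injective e) (OrderDual.toDual i)
    rw [Pi.single_eq_same, Pi.single_apply,
      if_neg (show ¬ OrderDual.toDual i = OrderDual.toDual j from h)] at this
    exact one_ne_zero this
  simp only [xvar, HahnSeries.coeff_add, HahnSeries.coeff_single_same,
    HahnSeries.coeff_single_of_ne hne, HahnSeries.coeff_zero] at this
  norm_num at this

lemma map_pairProd_mul {ι V R : Type*} [Ring R] [AddCommMonoid V] [Module ℂ V] (c : R → V)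
    {f : ι → ι → R} {g : ι → ι → Module.End ℂ V} (h : ∀ i j F, c (f i j * F) = g i j (c F))
    (l : List ι) (F : R) : c (pairProd f l * F) = pairProd g l (c F) := by
  have h1 : ∀ (i : ι) (l : List ι) F,
      c ((l.map (f i)).prod * F) = (l.map (g i)).prod (c F) := by
    intro i l
    induction l with
    | nil => intro F; simp
    | cons j l ih =>
      intro F
      rw [List.map_cons, List.prod_cons, List.map_cons, List.prod_cons, mul_assoc, h, ih,
        Module.End.mul_apply]
  induction l generalizing F with
  | nil => simp [pairProd]
  | cons i l ih => rw [pairProd, pairProd, mul_assoc, h1, ih, Module.End.mul_apply]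

lemma pairProd_div {ι K : Type*} [Field K] (f g : ι → ι → K) (l : List ι) :
    pairProd (fun i j => f i j / g i j) l = pairProd f l / pairProd g l := by
  induction l with
  | nil => simp [pairProd]
  | cons i l ih =>
    have : (l.map fun j => f i j / g i j).prod = (l.map (f i)).prod / (l.map (g i)).prod := by
      clear ih
      induction l with
      | nil => simp
      | cons j l ih => simp [ih, div_mul_div_comm]
    rw [pairProd, pairProd, pairProd, ih, this, div_mul_div_comm]

lemma pairProd_ne_zero {ι K : Type*} [Field K] {f : ι → ι → K} {l : List ι} (hl : l.Nodup)
    (h : ∀ i j, i ≠ j → f i j ≠ 0) : pairProd f l ≠ 0 := by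
  induction l with
  | nil => simp [pairProd]
  | cons i l ih =>
    rw [List.nodup_cons] at hl
    rw [pairProd]
    refine mul_ne_zero (List.prod_ne_zero fun h0 => ?_) (ih hl.2)
    obtain ⟨j, hj, e⟩ := List.mem_map.1 h0
    exact h i j (fun e => hl.1 (e ▸ hj)) e

lemma pairProd_eq_prod {ι R : Type*} [LinearOrder ι] [CommMonoid R] (f : ι → ι → R) {l : List ι}
    (hl : l.Pairwise (· < ·)) :
    pairProd f l = ∏ i ∈ l.toFinset, ∏ j ∈ l.toFinset with i < j, f i j := by
  induction l with
  | nil => simp [pairProd]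
  | cons i l ih =>
    rw [List.pairwise_cons] at hl
    have hi : i ∉ l.toFinset := fun h => lt_irrefl i (hl.1 i (List.mem_toFinset.1 h))
    rw [pairProd, ih hl.2, List.toFinset_cons, prod_insert hi]
    congr 1
    · rw [filter_insert, if_neg (lt_irrefl i), filter_true_of_mem, List.prod_toFinset]
      · exact hl.2.imp fun h => h.ne
      · exact fun j hj => hl.1 j (List.mem_toFinset.1 hj)
    · refine prod_congr rfl fun k hk => ?_
      rw [filter_insert, if_neg (hl.1 k (List.mem_toFinset.1 hk)).not_gt]

lemma Delta_eq (N : ℕ) : Delta N = pairProd (fun i j => xvar i - xvar j) (List.finRange N) /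
    pairProd (fun i j => xvar i + xvar j) (List.finRange N) := by
  rw [← pairProd_div, pairProd_eq_prod _ (List.pairwise_lt_finRange N), List.toFinset_finRange]
  refine prod_congr rfl fun i _ => prod_congr ?_ fun _ _ => rfl
  ext j
  simp

/-! ### Matrix elements of products of fermions -/

section Ferm

variable {ι : Type*}

/-- The functional `⟨0| + √2 ⟨0| φ₀` applied after a product of fermions. -/
def fermFun : List ι → (ι → ℤ) → Fock →ₗ[ℂ] ℂ
  | [], _ => lam
  | i :: l, a => fermFun l a ∘ₗ ferm (a i)

lemma lam_fermWord (l : List ι) (a : ι → ℤ) (v : Fock) : lam (fermWord l a v) = fermFun l a v := by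
  induction l generalizing v with
  | nil => rfl
  | cons i l ih => rw [fermWord, ih, fermFun, LinearMap.comp_apply]

/-- The functional `f` vanishes on the basis vectors of energy different from `e`. -/
def HasEnergy (f : Fock →ₗ[ℂ] ℂ) (e : ℤ) : Prop :=
  ∀ S : Finset ℕ, f (Finsupp.single S 1) ≠ 0 → ∑ s ∈ S, (s : ℤ) = e

lemma phiBasis_energy (f : Fock →ₗ[ℂ] ℂ) {e : ℤ} (hf : HasEnergy f e) (a : ℤ) (S : Finset ℕ)
    (h : f (phiBasis a S) ≠ 0) : ∑ s ∈ S, (s : ℤ) = e - a := by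
  have hs : ∀ (T : Finset ℕ) (c : ℂ), f (Finsupp.single T c) ≠ 0 → ∑ s ∈ T, (s : ℤ) = e := by
    intro T c hT
    apply hf T
    intro h0
    apply hT
    rw [show (Finsupp.single T c : Fock) = c • Finsupp.single T 1 by simp, map_smul, h0, smul_zero]
  unfold phiBasis at h
  dsimp only at h
  split_ifs at h with h1 h2 h3 h4 h5
  · simp at h
  · have := hs _ _ h
    rw [sum_insert h2] at this
    omega
  · have := hs _ _ h
    have h6 := add_sum_erase S (fun s => (s : ℤ)) h4
    omega
  · have := hs _ _ h
    rw [sum_insert h4] at this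
    omega
  · have := hs _ _ h
    have h6 := add_sum_erase S (fun s => (s : ℤ)) h5
    omega
  · simp at h

lemma HasEnergy.comp_ferm {f : Fock →ₗ[ℂ] ℂ} {e : ℤ} (hf : HasEnergy f e) (a : ℤ) :
    HasEnergy (f ∘ₗ ferm a) (e + a) := by
  intro S h
  rw [LinearMap.comp_apply, ferm, LinearMap.smul_apply, map_smul, phi_single] at h
  have := phiBasis_energy f hf (-a) S (fun h0 => h (by rw [h0, smul_zero]))
  omega

lemma hasEnergy_lam : HasEnergy lam 0 := by
  have h0 : HasEnergy leftVacuum 0 := by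
    intro S h
    rw [leftVacuum, Finsupp.lapply_apply, Finsupp.single_apply] at h
    split_ifs at h with hS
    · rw [hS, sum_empty]
    · exact absurd rfl h
  intro S h
  rw [lam_apply, phi_single] at h
  by_cases h1 : leftVacuum (Finsupp.single S 1) = 0
  · rw [h1, zero_add] at h
    simpa using phiBasis_energy leftVacuum h0 0 S (right_ne_zero_of_mul h)
  · exact h0 S h1

lemma hasEnergy_fermFun (l : List ι) (a : ι → ℤ) : HasEnergy (fermFun l a) (l.map a).sum := by
  induction l with
  | nil => exact hasEnergy_lam
  | cons i l ih =>
    rw [List.map_cons, List.sum_cons, add_comm]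
    exact ih.comp_ferm (a i)

lemma HasEnergy.nonneg {f : Fock →ₗ[ℂ] ℂ} {e : ℤ} (hf : HasEnergy f e) {v : Fock} (h : f v ≠ 0) :
    0 ≤ e := by
  by_contra he
  apply h
  suffices f = 0 by rw [this, LinearMap.zero_apply]
  refine end_ext fun S => ?_
  by_contra h0
  have := hf S h0
  have : 0 ≤ ∑ s ∈ S, (s : ℤ) := sum_nonneg fun s _ => Int.natCast_nonneg s
  omega

/-- Each tail of the word is a functional supported on the energy equal to its exponent sum, and the
Fock space has no negative energies. So all tail sums of exponents are nonnegative, which fits the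
expansion in |x₁| > ⋯ > |x_N|. -/
lemma fermFun_support [LinearOrder ι] {l : List ι} (hl : l.Pairwise (· < ·)) {a : ι → ℤ} {v : Fock}
    (h : fermFun l a v ≠ 0) : ∀ i ∈ l, 0 ≤ ∑ k ∈ l.toFinset with i ≤ k, a k := by
  induction l generalizing v with
  | nil => simp
  | cons j l ih =>
    have hl' := List.pairwise_cons.1 hl
    intro i hi
    rcases List.mem_cons.1 hi with rfl | hi
    · have := (hasEnergy_fermFun (i :: l) a).nonneg h
      rw [filter_true_of_mem, List.sum_toFinset _ (hl.imp fun h => h.ne)]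
      · exact this
      · intro k hk
        rcases List.mem_cons.1 (List.mem_toFinset.1 hk) with rfl | hk
        · exact le_rfl
        · exact (hl'.1 k hk).le
    · rw [List.toFinset_cons, filter_insert, if_neg (hl'.1 i hi).not_ge]
      exact ih hl'.2 h i hi

end Ferm

/-! ### Well-ordered supports and the two generating functions. -/

lemma le_of_tail_sums_le {a b : Expo N}
    (h : ∀ i, ∑ k with i ≤ k, expo a k ≤ ∑ k with i ≤ k, expo b k) : a ≤ b := by
  by_contra hab
  obtain ⟨i, hi, hlt⟩ := not_le.1 hab
  have hi' : ∀ k, OrderDual.ofDual i < k → expo b k = expo a k := fun k hk =>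
    hi (OrderDual.toDual k) hk
  have hlt' : expo b (OrderDual.ofDual i) < expo a (OrderDual.ofDual i) := hlt
  refine (h (OrderDual.ofDual i)).not_gt (sum_lt_sum (fun k hk => ?_)
    ⟨OrderDual.ofDual i, by simp, hlt'⟩)
  rcases (mem_filter.1 hk).2.eq_or_lt with e | e
  · rw [← e]; exact hlt'.le
  · exact (hi' k e).le

/-- Tail sums map this set into ℕᴺ, where Dickson's lemma applies, and a comparison of all tail sums
implies one in the lexicographic order. -/
lemma isPWO_tail_sums (N : ℕ) :
    {a : Expo N | ∀ i, 0 ≤ ∑ k with i ≤ k, expo a k}.IsPWO := by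
  have h : (Set.univ : Set (Fin N → ℕ)).IsPWO := Set.isPWO_of_wellQuasiOrderedLE _
  intro f
  obtain ⟨m, n, hmn, hle⟩ := h fun n =>
    ⟨fun i => (∑ k with i ≤ k, expo (f n : Expo N) k).toNat, trivial⟩
  refine ⟨m, n, hmn, le_of_tail_sums_le fun i => ?_⟩
  have h1 := hle i
  have h2 := (f m).2 i
  have h3 := (f n).2 i
  dsimp only at h1
  omega

/-- The generating function `2^{N/2} (⟨0| + √2 ⟨0| φ₀) φ(-1/x_N) ⋯ φ(-1/x_1) v`. -/
def fermGen (N : ℕ) : Fock →ₗ[ℂ] Laurent N where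
  toFun v :=
    { coeff := fun e => fermFun (List.finRange N) (expo e) v
      isPWO_support' := (isPWO_tail_sums N).mono fun e he i => by
        have := fermFun_support (List.pairwise_lt_finRange N) he i (List.mem_finRange i)
        rwa [List.toFinset_finRange] at this }
  map_add' u v := by ext e; exact map_add _ _ _
  map_smul' c v := by ext e; exact map_smul _ _ _

lemma vertWord_eq_zero {ι : Type*} {l : List ι} {a : ι → ℤ} {i : ι} (hi : i ∈ l) (ha : a i < 0)
    (v : Fock) : vertWord l a v = 0 := by
  induction l with
  | nil => simp at hi
  | cons j l ih =>
    rw [vertWord]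
    rcases List.mem_cons.1 hi with rfl | hi
    · rw [vertInt, if_neg ha.not_ge, LinearMap.zero_apply]
    · rw [ih hi, map_zero]

/-- The generating function `(⟨0| + √2 ⟨0| φ₀) exp (∑ t_m(x) H_m) v`. -/
def vertGen (N : ℕ) (v : Fock) : Laurent N where
  coeff e := lam (vertWord (List.finRange N) (expo e) v)
  isPWO_support' := (isPWO_nonneg N).mono fun e he i => by
    by_contra h
    exact he (by
      dsimp only
      rw [vertWord_eq_zero (List.mem_finRange i) (not_le.1 h), map_zero])

/-- The bosonic and the fermionic generating functions are proportional. -/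
theorem Delta_mul_vertGen (v : Fock) : Delta N * vertGen N v = fermGen N v := by
  have h := lam_vertWord (List.nodup_finRange N) (T := fun _ => v) fun _ _ _ _ _ => rfl
  have hp : pairProd (fun i j => xvar i + xvar j) (List.finRange N) * fermGen N v =
      pairProd (fun i j => xvar i - xvar j) (List.finRange N) * vertGen N v := by
    apply coeffFun_injective
    rw [map_pairProd_mul (coeffFun (N := N)) (g := fun i j => shift i + shift j)
        fun i j F => by
          rw [add_mul, map_add, coeffFun_xvar_mul, coeffFun_xvar_mul, LinearMap.add_apply],
      map_pairProd_mul (coeffFun (N := N)) (g := fun i j => shift i - shift j)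
        fun i j F => by
          rw [sub_mul, map_sub, coeffFun_xvar_mul, coeffFun_xvar_mul, LinearMap.sub_apply]]
    refine Eq.trans ?_ h
    congr 1
    funext a
    rw [lam_fermWord]
    rfl
  -- Both generating functions lie in a field, so the factors x_i + x_j may now be cancelled.
  have h0 : pairProd (fun i j : Fin N => xvar i + xvar j) (List.finRange N) ≠ 0 :=
    pairProd_ne_zero (List.nodup_finRange N) fun i j hij => xvar_add_xvar_ne_zero hij
  rw [Delta_eq, div_mul_eq_mul_div, ← hp]
  exact mul_div_cancel_left₀ _ h0

lemma vertGen_vacuum : vertGen N vacuum = 1 := by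
  have hv : ∀ k : ℤ, vertInt k vacuum = if k = 0 then vacuum else 0 := by
    intro k
    rw [vertInt]
    rcases lt_trichotomy k 0 with hk | rfl | hk
    · rw [if_neg hk.not_ge, if_neg hk.ne, LinearMap.zero_apply]
    · simp [vert_zero]
    · rw [if_pos hk.le, if_neg hk.ne', vert_vacuum (by omega)]
  ext e
  rw [HahnSeries.coeff_one]
  change lam (vertWord (List.finRange N) (expo e) vacuum) = _
  split_ifs with h
  · have : ∀ l : List (Fin N), vertWord l (expo e) vacuum = vacuum := by
      intro l
      induction l with
      | nil => rfl
      | cons i l ih =>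
        rw [vertWord, ih, hv, if_pos]
        rw [h]; rfl
    rw [this, lam_vacuum]
  · obtain ⟨i, hi⟩ : ∃ i, expo e i ≠ 0 := by
      by_contra! hc
      exact h (funext fun i => hc (OrderDual.ofDual i))
    have : ∀ l : List (Fin N), vertWord l (expo e) vacuum = vacuum ∨
        vertWord l (expo e) vacuum = 0 := by
      intro l
      induction l with
      | nil => exact Or.inl rfl
      | cons j l ih =>
        rw [vertWord]
        rcases ih with ih | ih
        · rw [ih, hv]; split_ifs <;> simp
        · rw [ih, map_zero]; simp
    have : ∀ l : List (Fin N), i ∈ l → vertWord l (expo e) vacuum = 0 := by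
      intro l hl
      induction l with
      | nil => simp at hl
      | cons j l ih =>
        rw [vertWord]
        rcases List.mem_cons.1 hl with rfl | hl
        · rcases this l with h | h
          · rw [h, hv, if_neg hi]
          · rw [h, map_zero]
        · rw [ih hl, map_zero]
    rw [this _ (List.mem_finRange i), map_zero]

/-- The vacuum case of the proportionality evaluates the correlator of fermions without Wick's
theorem or a Pfaffian identity. -/
lemma fermGen_vacuum : fermGen N vacuum = Delta N := by
  rw [← Delta_mul_vertGen, vertGen_vacuum, mul_one]

/-! ### The operators `x_i r(-D_{x_i})` -/

/-- The operator `x_i r(-D_{x_i})`. -/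
def xShift (r : ℤ → ℂ) (i : Fin N) : Module.End ℂ (Laurent N) :=
  LinearMap.mulLeft ℂ (xvar i) * funcEuler (fun n => r (-n)) i

lemma coeffFun_xShift (r : ℤ → ℂ) (i : Fin N) (F : Laurent N) (a : Fin N → ℤ) :
    coeffFun (xShift r i F) a = r (1 - a i) * coeffFun F (a - Pi.single i 1) := by
  rw [xShift, Module.End.mul_apply, LinearMap.mulLeft_apply, coeffFun_xvar_mul, shift_apply]
  change r (-((a - Pi.single i 1 : Fin N → ℤ) i)) * _ = _
  rw [Pi.sub_apply, Pi.single_eq_same, neg_sub]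
  rfl

lemma coeffFun_xShift_pow (r : ℤ → ℂ) (i : Fin N) (m : ℕ) (F : Laurent N) (a : Fin N → ℤ) :
    coeffFun ((xShift r i ^ m) F) a =
      (∏ l ∈ range m, r (-a i + l + 1)) * coeffFun F (a - Pi.single i (m : ℤ)) := by
  induction m generalizing a with
  | zero => simp
  | succ m ih =>
    rw [pow_succ', Module.End.mul_apply, coeffFun_xShift, ih, prod_range_succ', Pi.sub_apply,
      Pi.single_eq_same, sub_sub, ← Pi.single_add, Nat.cast_zero, add_zero,
      show (1 : ℤ) + m = (m + 1 : ℕ) by push_cast; ring, show 1 - a i = -a i + 1 by ring]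
    have : ∀ l ∈ range m, r (-(a i - 1) + l + 1) = r (-a i + (l + 1 : ℕ) + 1) := by
      intro l _
      congr 1
      push_cast
      ring
    rw [prod_congr rfl this]
    ring

lemma xShift_commute (r : ℤ → ℂ) (i j : Fin N) : Commute (xShift r i) (xShift r j) := by
  by_cases h : i = j
  · rw [h]
  refine LinearMap.ext fun F => coeffFun_injective (funext fun a => ?_)
  rw [Module.End.mul_apply, Module.End.mul_apply, coeffFun_xShift, coeffFun_xShift,
    coeffFun_xShift, coeffFun_xShift, Pi.sub_apply, Pi.sub_apply, Pi.single_eq_of_ne (Ne.symm h),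
    Pi.single_eq_of_ne h, sub_zero, sub_zero, sub_right_comm]
  ring

lemma ferm_B {r : ℤ → ℂ} (hr : ∀ n, r n = r (1 - n)) {m : ℕ} (hm : Odd m) (a : ℤ) (v : Fock) :
    ferm a (B r m v) = B r m (ferm a v) - (∏ l ∈ range m, r (-a + l + 1)) • ferm (a - m) v := by
  have e : (-1 : ℂ) ^ (a - m) = -(-1) ^ a := by
    rw [sub_eq_add_neg, zpow_add₀ (by norm_num), neg_one_zpow_neg, zpow_natCast, hm.neg_one_pow]
    ring
  rw [ferm, ferm, LinearMap.smul_apply, LinearMap.smul_apply, LinearMap.smul_apply, map_smul,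
    B_phi hr hm, e, neg_sub, sub_eq_add_neg (m : ℤ) a, add_comm (m : ℤ) (-a)]
  module

lemma fermFun_congr {ι : Type*} {l : List ι} {a b : ι → ℤ} (h : ∀ i ∈ l, a i = b i) :
    fermFun l a = fermFun l b := by
  induction l with
  | nil => rfl
  | cons i l ih =>
    rw [fermFun, fermFun, ih fun j hj => h j (List.mem_cons_of_mem _ hj), h i List.mem_cons_self]

/-- The operator Bₘ moves left until λ kills it. Each fermion it crosses leaves a commutator with
its exponent lowered by m, weighted as in `coeffFun_xShift_pow`. -/
lemma fermFun_B {ι : Type*} [DecidableEq ι] {r : ℤ → ℂ} (hr : ∀ n, r n = r (1 - n)) {m : ℕ}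
    (hm : Odd m) {l : List ι} (hl : l.Nodup) (a : ι → ℤ) (v : Fock) :
    fermFun l a (B r m v) = -∑ i ∈ l.toFinset,
      (∏ k ∈ range m, r (-a i + k + 1)) * fermFun l (a - Pi.single i (m : ℤ)) v := by
  induction l generalizing v with
  | nil => simpa [fermFun] using lam_B r hm.pos v
  | cons i l ih =>
    rw [List.nodup_cons] at hl
    have hi : i ∉ l.toFinset := fun h => hl.1 (List.mem_toFinset.1 h)
    have hc : fermFun l (a - Pi.single i (m : ℤ)) = fermFun l a := fermFun_congr fun j hj => by
      rw [Pi.sub_apply, Pi.single_eq_of_ne, sub_zero]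
      rintro rfl
      exact hl.1 hj
    rw [List.toFinset_cons, sum_insert hi, fermFun, LinearMap.comp_apply, ferm_B hr hm, map_sub,
      map_smul, ih hl.2, fermFun, LinearMap.comp_apply, Pi.sub_apply, Pi.single_eq_same, hc,
      smul_eq_mul, neg_add, add_comm, sub_eq_add_neg, add_comm, add_comm (-(_ * _))]
    congr 2
    refine sum_congr rfl fun j hj => ?_
    rw [fermFun, LinearMap.comp_apply, Pi.sub_apply, Pi.single_eq_of_ne, sub_zero]
    rintro rfl
    exact hi hj

/-- The operators `B_m` act on the fermionic generating function by shifts. -/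
theorem fermGen_B {r : ℤ → ℂ} (hr : ∀ n, r n = r (1 - n)) {m : ℕ} (hm : Odd m) (v : Fock) :
    fermGen N (B r m v) = -(∑ i, xShift r i ^ m) (fermGen N v) := by
  refine coeffFun_injective (funext fun a => ?_)
  rw [map_neg, LinearMap.sum_apply, map_sum, Pi.neg_apply, Finset.sum_apply]
  simp only [coeffFun_xShift_pow]
  refine (fermFun_B hr hm (List.nodup_finRange N) a v).trans ?_
  rw [List.toFinset_finRange]
  rfl

/-! ### Operators raising the degree -/

variable {M : ℕ}

/-- The coefficients of degree less than `d` vanish. -/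
def VanishesBelow (d : ℕ) (F : Mixed N M) : Prop :=
  ∀ m, m.degree < d → MvPowerSeries.coeff m F = 0

/-- The operator `A` raises the degree in `y` by at least one. -/
def Raises (A : Module.End ℂ (Mixed N M)) : Prop :=
  ∀ d F, VanishesBelow d F → VanishesBelow (d + 1) (A F)

lemma vanishesBelow_zero (F : Mixed N M) : VanishesBelow 0 F := fun _ h => absurd h (by omega)

lemma VanishesBelow.mono {d e : ℕ} {F : Mixed N M} (h : VanishesBelow e F) (hd : d ≤ e) :
    VanishesBelow d F := fun m hm => h m (by omega)

lemma Raises.pow {A : Module.End ℂ (Mixed N M)} (hA : Raises A) {d : ℕ} {F : Mixed N M}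
    (hF : VanishesBelow d F) (k : ℕ) : VanishesBelow (d + k) ((A ^ k) F) := by
  induction k with
  | zero => exact hF
  | succ k ih =>
    rw [pow_succ', Module.End.mul_apply]
    exact hA _ _ ih

lemma Raises.sq {A : Module.End ℂ (Mixed N M)} (hA : Raises A) : Raises (A ^ 2) := fun _ _ hF =>
  (hA.pow hF 2).mono (by omega)

lemma coeff_geom (A : Module.End ℂ (Mixed N M)) (F : Mixed N M) (m : Fin M →₀ ℕ) :
    MvPowerSeries.coeff m (geom A F) =
      ∑ k ∈ range (m.degree + 1), MvPowerSeries.coeff m ((A ^ k) F) := rfl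

lemma coeff_geom_of_lt {A : Module.End ℂ (Mixed N M)} (hA : Raises A) (F : Mixed N M)
    {m : Fin M →₀ ℕ} {n : ℕ} (h : m.degree < n) :
    MvPowerSeries.coeff m (geom A F) = ∑ k ∈ range n, MvPowerSeries.coeff m ((A ^ k) F) := by
  rw [coeff_geom]
  refine sum_subset (range_mono (by omega)) fun k _ hk => ?_
  rw [mem_range] at hk
  exact hA.pow (vanishesBelow_zero F) k m (by omega)

lemma vanishesBelow_geom_sub {A : Module.End ℂ (Mixed N M)} (hA : Raises A) (F : Mixed N M)
    (n : ℕ) : VanishesBelow n (geom A F - ∑ k ∈ range n, (A ^ k) F) := fun m hm => by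
  rw [map_sub, map_sum, coeff_geom_of_lt hA F hm, sub_self]

/-- Since T raises the degree, the terms Aᵏ with k ≥ n of the geometric series contribute to T only
in degrees above n. -/
lemma coeff_mul_geom {A T : Module.End ℂ (Mixed N M)} (hA : Raises A) (hT : Raises T)
    (F : Mixed N M) {m : Fin M →₀ ℕ} {n : ℕ} (h : m.degree < n + 1) :
    MvPowerSeries.coeff m (T (geom A F)) =
      ∑ k ∈ range n, MvPowerSeries.coeff m (T ((A ^ k) F)) := by
  have := hT _ _ (vanishesBelow_geom_sub hA F n) m h
  rw [map_sub, map_sub, sub_eq_zero, map_sum, map_sum] at this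
  exact this

lemma geom_mul_one_sub {A : Module.End ℂ (Mixed N M)} (hA : Raises A) :
    geom A * (1 - A) = 1 := by
  refine LinearMap.ext fun F => MvPowerSeries.ext fun m => ?_
  have h1 : ∀ k, MvPowerSeries.coeff m ((A ^ k) ((1 - A) F)) =
      MvPowerSeries.coeff m ((A ^ k) F) - MvPowerSeries.coeff m ((A ^ (k + 1)) F) := fun k => by
    rw [LinearMap.sub_apply, Module.End.one_apply, map_sub, map_sub, pow_succ,
      Module.End.mul_apply]
  rw [Module.End.mul_apply, coeff_geom]
  simp only [h1]
  rw [sum_range_sub' fun k => MvPowerSeries.coeff m ((A ^ k) F),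
    hA.pow (vanishesBelow_zero F) (m.degree + 1) m (by omega)]
  simp

lemma one_sub_mul_geom {A : Module.End ℂ (Mixed N M)} (hA : Raises A) :
    (1 - A) * geom A = 1 := by
  refine LinearMap.ext fun F => MvPowerSeries.ext fun m => ?_
  have h1 : ∀ k, MvPowerSeries.coeff m (A ((A ^ k) F)) =
      MvPowerSeries.coeff m ((A ^ (k + 1)) F) := fun k => by
    rw [pow_succ', Module.End.mul_apply]
  rw [Module.End.mul_apply, LinearMap.sub_apply, Module.End.one_apply, map_sub,
    coeff_mul_geom hA hA F (n := m.degree + 1) (by omega), coeff_geom]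
  simp only [h1]
  rw [← sum_sub_distrib, sum_range_sub' fun k => MvPowerSeries.coeff m ((A ^ k) F),
    hA.pow (vanishesBelow_zero F) (m.degree + 1) m (by omega)]
  simp

/-! ### Commutation relations -/

lemma coeff_X_mul (j : Fin M) (F : Mixed N M) (m : Fin M →₀ ℕ) :
    MvPowerSeries.coeff m (MvPowerSeries.X j * F) =
      if 1 ≤ m j then MvPowerSeries.coeff (m - Finsupp.single j 1) F else 0 := by
  rw [MvPowerSeries.X, MvPowerSeries.coeff_monomial_mul]
  simp only [Finsupp.single_le_iff, one_mul]

lemma coeff_shiftOp (r : ℤ → ℂ) (i : Fin N) (j : Fin M) (F : Mixed N M) (m : Fin M →₀ ℕ) :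
    MvPowerSeries.coeff m (shiftOp r i j F) =
      if 1 ≤ m j then xShift r i (MvPowerSeries.coeff (m - Finsupp.single j 1) F) else 0 := by
  rw [shiftOp, Module.End.mul_apply, LinearMap.mulLeft_apply, coeff_X_mul]
  rfl

lemma coeff_eulerY (j : Fin M) (F : Mixed N M) (m : Fin M →₀ ℕ) :
    MvPowerSeries.coeff m (eulerY j F) = m j • MvPowerSeries.coeff m F := by
  rw [eulerY, Module.End.mul_apply, LinearMap.mulLeft_apply, coeff_X_mul]
  split_ifs with h
  · refine (MvPowerSeries.coeff_pderiv (R := Laurent N) (i := j) F _).trans ?_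
    rw [tsub_add_cancel_of_le (Finsupp.single_le_iff.2 h), Finsupp.tsub_apply,
      Finsupp.single_eq_same, nsmul_eq_mul, mul_comm, ← Nat.cast_succ, Nat.succ_eq_add_one,
      Nat.sub_add_cancel h]
  · rw [show m j = 0 by omega, zero_smul]

lemma coeff_shiftOp_pow (r : ℤ → ℂ) (i : Fin N) (j : Fin M) (k : ℕ) (F : Mixed N M)
    (m : Fin M →₀ ℕ) : MvPowerSeries.coeff m ((shiftOp r i j ^ k) F) =
      if k ≤ m j then (xShift r i ^ k) (MvPowerSeries.coeff (m - Finsupp.single j k) F) else 0 := by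
  induction k generalizing m with
  | zero => simp
  | succ k ih =>
    rw [pow_succ', Module.End.mul_apply, coeff_shiftOp, ih, Finsupp.tsub_apply,
      Finsupp.single_eq_same, tsub_tsub, ← Finsupp.single_add, add_comm 1 k]
    by_cases h : k + 1 ≤ m j
    · rw [if_pos (by omega), if_pos (by omega), if_pos h, pow_succ', Module.End.mul_apply]
    · rw [if_neg h]
      split_ifs
      · omega
      · exact map_zero _
      · rfl

lemma raises_shiftOp (r : ℤ → ℂ) (i : Fin N) (j : Fin M) : Raises (shiftOp r i j) := by
  intro d F hF m hm
  rw [coeff_shiftOp]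
  split_ifs with h
  · have := congrArg Finsupp.degree (tsub_add_cancel_of_le (Finsupp.single_le_iff.2 h))
    rw [map_add, Finsupp.degree_single] at this
    rw [hF _ (by omega), map_zero]
  · rfl

lemma shiftOp_commute (r : ℤ → ℂ) (i i' : Fin N) (j j' : Fin M) :
    Commute (shiftOp r i j) (shiftOp r i' j') := by
  refine LinearMap.ext fun F => MvPowerSeries.ext fun m => ?_
  rw [Module.End.mul_apply, Module.End.mul_apply]
  simp only [coeff_shiftOp]
  have hx := LinearMap.congr_fun (xShift_commute r i i')
  simp only [Module.End.mul_apply] at hx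
  by_cases hj : j = j'
  · subst hj
    split_ifs <;> simp [hx]
  · rw [Finsupp.tsub_apply, Finsupp.tsub_apply, Finsupp.single_apply, Finsupp.single_apply,
      if_neg hj, if_neg (Ne.symm hj), tsub_right_comm, Nat.sub_zero, Nat.sub_zero]
    split_ifs <;> simp [hx]

lemma eulerY_shiftOp_same (r : ℤ → ℂ) (i : Fin N) (j : Fin M) :
    eulerY j * shiftOp r i j = shiftOp r i j * eulerY j + shiftOp r i j := by
  refine LinearMap.ext fun F => MvPowerSeries.ext fun m => ?_
  rw [LinearMap.add_apply, Module.End.mul_apply, Module.End.mul_apply, coeff_eulerY, map_add]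
  simp only [coeff_shiftOp, coeff_eulerY]
  split_ifs with h
  · rw [Finsupp.tsub_apply, Finsupp.single_eq_same, map_nsmul, ← succ_nsmul, Nat.sub_add_cancel h]
  · simp

lemma eulerY_commute_shiftOp (r : ℤ → ℂ) (i : Fin N) {j j' : Fin M} (hj : j ≠ j') :
    Commute (eulerY j) (shiftOp r i j') := by
  refine LinearMap.ext fun F => MvPowerSeries.ext fun m => ?_
  rw [Module.End.mul_apply, Module.End.mul_apply, coeff_eulerY]
  simp only [coeff_shiftOp, coeff_eulerY]
  split_ifs with h
  · rw [Finsupp.tsub_apply, Finsupp.single_eq_of_ne hj, Nat.sub_zero, map_nsmul]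
  · simp

section Ring

variable {R : Type*} [Ring R]

lemma commute_of_inverse {A g x : R} (h1 : g * (1 - A) = 1) (h2 : (1 - A) * g = 1)
    (hx : Commute x A) : Commute x g := by
  have h : Commute x (1 - A) := (Commute.one_right x).sub_right hx
  calc x * g = g * (1 - A) * x * g := by rw [h1, one_mul]
    _ = g * (x * (1 - A)) * g := by rw [mul_assoc g, ← h.eq]
    _ = g * x := by rw [mul_assoc, mul_assoc, h2, mul_one]

/-- If [D, A] = A then [D, f(A)] = A f'(A). For f(A) = (1 + A)/(1 - A) the logarithmic derivative A
f'/f is 2A/(1 - A²); here g and s stand for the inverses of 1 - A and 1 - A². -/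
lemma derivation_cayley {D A g s : R} (hD : D * A = A * D + A) (h1 : g * (1 - A) = 1)
    (h2 : (1 - A) * g = 1) (h3 : s * (1 - A ^ 2) = 1) (h4 : (1 - A ^ 2) * s = 1) :
    D * ((1 + A) * g) = (1 + A) * g * D + 2 • (A * s) * ((1 + A) * g) := by
  have hg : Commute A g := commute_of_inverse h1 h2 (Commute.refl A)
  have hs : Commute A s := commute_of_inverse h3 h4 ((Commute.refl A).pow_right 2)
  have hsg : s * (1 + A) = g := by
    calc s * (1 + A) = s * (1 + A) * ((1 - A) * g) := by rw [h2, mul_one]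
      _ = s * (1 - A ^ 2) * g := by noncomm_ring
      _ = g := by rw [h3, one_mul]
  have hc : (1 - A) * D = D * (1 - A) + A := by
    rw [mul_sub, hD]; noncomm_ring
  have hDg : D * g = g * D + g * A * g := by
    calc D * g = g * (1 - A) * D * g := by rw [h1, one_mul]
      _ = g * (D * (1 - A) + A) * g := by rw [mul_assoc g, hc]
      _ = g * D * ((1 - A) * g) + g * A * g := by noncomm_ring
      _ = g * D + g * A * g := by rw [h2, mul_one]
  have e1 : D * ((1 + A) * g) = (1 + A) * g * D + (A * g + (1 + A) * (g * A * g)) := by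
    calc D * ((1 + A) * g) = (D + D * A) * g := by noncomm_ring
      _ = (1 + A) * (D * g) + A * g := by rw [hD]; noncomm_ring
      _ = _ := by rw [hDg]; noncomm_ring
  have e2 : A * g + (1 + A) * (g * A * g) = 2 • (A * g * g) := by
    have : A * g = A * g * ((1 - A) * g) := by rw [h2, mul_one]
    have h5 : g * A * g = A * g * g := by rw [hg.eq]
    have h6 : A * g * ((1 - A) * g) = A * g * g - A * (A * g * g) := by
      rw [sub_mul, one_mul, mul_sub, ← mul_assoc (A * g) A g, mul_assoc A g A, ← hg.eq]
      noncomm_ring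
    rw [h5]
    refine (congrArg (· + _) (this.trans h6)).trans ?_
    noncomm_ring
  rw [e1, e2]
  congr 1
  rw [smul_mul_assoc, ← mul_assoc, mul_assoc A s, hsg]

lemma derivation_list_prod {ι : Type*} {D : R} {g k : ι → R}
    (h : ∀ i, D * g i = g i * D + k i * g i) (hc : ∀ i j, Commute (k i) (g j)) (l : List ι) :
    D * (l.map g).prod = (l.map g).prod * D + (l.map k).sum * (l.map g).prod := by
  induction l with
  | nil => simp
  | cons i l ih =>
    have hs : Commute (l.map k).sum (g i) := by
      clear ih
      induction l with
      | nil => simp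
      | cons j l ih => rw [List.map_cons, List.sum_cons]; exact (hc j i).add_left ih
    simp only [List.map_cons, List.prod_cons, List.sum_cons]
    rw [← mul_assoc, h, add_mul, mul_assoc (g i) D, ih, mul_add, add_mul, ← mul_assoc (g i) _ _,
      ← mul_assoc (g i) _ _, ← hs.eq]
    noncomm_ring

end Ring

/-! ### The product operator and the linear equations. -/

/-- The operator `(1 + A) (1 - A)⁻¹`. -/
def cayley (A : Module.End ℂ (Mixed N M)) : Module.End ℂ (Mixed N M) := (1 + A) * geom A

lemma commute_geom {A T : Module.End ℂ (Mixed N M)} (hA : Raises A) (h : Commute T A) :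
    Commute T (geom A) :=
  commute_of_inverse (geom_mul_one_sub hA) (one_sub_mul_geom hA) h

lemma commute_cayley {A T : Module.End ℂ (Mixed N M)} (hA : Raises A) (h : Commute T A) :
    Commute T (cayley A) :=
  ((Commute.one_right T).add_right h).mul_right (commute_geom hA h)

lemma prodOp_eq (r : ℤ → ℂ) (N M : ℕ) : prodOp r N M =
    ((List.finRange N).map fun i => ((List.finRange M).map fun j =>
      cayley (shiftOp r i j)).prod).prod := by
  simp only [prodOp, List.ofFn_eq_map]
  rfl

lemma commute_kernel (r : ℤ → ℂ) (i i' : Fin N) (j j' : Fin M) :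
    Commute (2 • (shiftOp r i j * geom (shiftOp r i j ^ 2))) (cayley (shiftOp r i' j')) := by
  have hA := raises_shiftOp r i j
  have h1 := shiftOp_commute r i i' j j'
  have h2 : Commute (geom (shiftOp r i j ^ 2)) (shiftOp r i' j') :=
    (commute_geom hA.sq (h1.symm.pow_right 2)).symm
  exact commute_cayley (raises_shiftOp r i' j') ((h1.mul_left h2).smul_left 2)

/-- Logarithmic derivatives of commuting factors add up, and only the factors containing y_j
contribute. -/
lemma eulerY_prodOp (r : ℤ → ℂ) (j : Fin M) : eulerY j * prodOp r N M =
    prodOp r N M * eulerY j +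
      (2 • ∑ i, shiftOp r i j * geom (shiftOp r i j ^ 2)) * prodOp r N M := by
  rw [prodOp_eq, derivation_list_prod (k := fun i => 2 • (shiftOp r i j * geom (shiftOp r i j ^ 2)))]
  · congr 2
    rw [← List.ofFn_eq_map, List.sum_ofFn, smul_sum]
  · intro i
    rw [derivation_list_prod (k := fun j' => if j' = j then
      2 • (shiftOp r i j * geom (shiftOp r i j ^ 2)) else 0)]
    · congr 2
      rw [← List.ofFn_eq_map, List.sum_ofFn, sum_ite_eq', if_pos (mem_univ j)]
    · intro j'
      split_ifs with h
      · subst h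
        have hA := raises_shiftOp r i j'
        exact derivation_cayley (eulerY_shiftOp_same r i j') (geom_mul_one_sub hA)
          (one_sub_mul_geom hA) (geom_mul_one_sub hA.sq) (one_sub_mul_geom hA.sq)
      · rw [zero_mul, add_zero]
        exact commute_cayley (raises_shiftOp r i j') (eulerY_commute_shiftOp r i (Ne.symm h))
    · intro j' j''
      split_ifs
      · exact commute_kernel r i i j j''
      · exact Commute.zero_left _
  · intro i i'
    exact commute_map_prod (fun j' => commute_kernel r i i' j j') _

lemma eulerY_DeltaX (j : Fin M) : eulerY j (DeltaX N M) = 0 := by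
  classical
  refine MvPowerSeries.ext fun m => ?_
  rw [coeff_eulerY, DeltaX, MvPowerSeries.coeff_C]
  split_ifs with h
  · simp [h]
  · simp

lemma linOp_prodOp (r : ℤ → ℂ) (j : Fin M) : linOp r N M j (prodOp r N M (DeltaX N M)) = 0 := by
  have h := LinearMap.congr_fun (eulerY_prodOp (N := N) r j) (DeltaX N M)
  rw [LinearMap.add_apply, Module.End.mul_apply, Module.End.mul_apply, Module.End.mul_apply,
    eulerY_DeltaX, map_zero, zero_add] at h
  rw [linOp, LinearMap.sub_apply, h, sub_self]

lemma coeff_zero_cayley (r : ℤ → ℂ) (i : Fin N) (j : Fin M) (F : Mixed N M) :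
    MvPowerSeries.coeff 0 (cayley (shiftOp r i j) F) = MvPowerSeries.coeff 0 F := by
  rw [cayley, Module.End.mul_apply, LinearMap.add_apply, map_add, coeff_shiftOp, if_neg (by simp),
    add_zero, Module.End.one_apply, coeff_geom]
  simp

lemma coeff_zero_list_prod {ι : Type*} {g : ι → Module.End ℂ (Mixed N M)}
    (h : ∀ i F, MvPowerSeries.coeff 0 (g i F) = MvPowerSeries.coeff 0 F) (l : List ι)
    (F : Mixed N M) :
    MvPowerSeries.coeff 0 ((l.map g).prod F) = MvPowerSeries.coeff 0 F := by
  induction l with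
  | nil => rfl
  | cons i l ih => rw [List.map_cons, List.prod_cons, Module.End.mul_apply, h, ih]

lemma coeff_zero_prodOp (r : ℤ → ℂ) (F : Mixed N M) :
    MvPowerSeries.coeff 0 (prodOp r N M F) = MvPowerSeries.coeff 0 F := by
  rw [prodOp_eq]
  exact coeff_zero_list_prod (fun i F => coeff_zero_list_prod
    (fun j F => coeff_zero_cayley r i j F) _ F) _ F

/-- The linear equations determine a series by its value at `y = 0`. -/
theorem eq_zero_of_linOp {r : ℤ → ℂ} {F : Mixed N M} (h : ∀ j, linOp r N M j F = 0)
    (h0 : MvPowerSeries.coeff 0 F = 0) : F = 0 := by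
  suffices hd : ∀ d, VanishesBelow d F from
    MvPowerSeries.ext fun m => hd (m.degree + 1) m (by omega)
  intro d
  induction d with
  | zero => exact vanishesBelow_zero F
  | succ d ih =>
    intro m hm
    by_cases hm0 : m = 0
    · rw [hm0, h0]
    obtain ⟨j, hj⟩ := Finsupp.ne_iff.1 hm0
    -- The integral part of the equation raises the degree, so in the lowest surviving degree only
    -- the Euler term remains, with the nonzero factor m j.
    have hz : ∀ i, MvPowerSeries.coeff m
        ((shiftOp r i j * geom (shiftOp r i j ^ 2) : Module.End ℂ (Mixed N M)) F) = 0 := by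
      intro i
      rw [Module.End.mul_apply]
      refine raises_shiftOp r i j d _ (fun m' hm' => ?_) m hm
      rw [coeff_geom]
      exact sum_eq_zero fun k _ =>
        (((raises_shiftOp r i j).sq.pow ih k).mono (Nat.le_add_right d k)) m' hm'
    have e := congrArg (MvPowerSeries.coeff m) (h j)
    rw [linOp, LinearMap.sub_apply, LinearMap.smul_apply, LinearMap.sum_apply, map_sub, map_nsmul,
      map_sum, sum_eq_zero fun i _ => hz i, coeff_eulerY, smul_zero, sub_zero, map_zero,
      ← Nat.cast_smul_eq_nsmul ℂ] at e
    exact (smul_eq_zero.1 e).resolve_left (by exact_mod_cast hj)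

/-- The equations in terms of coefficients. -/
lemma linOp_eq_zero {r : ℤ → ℂ} {F : Mixed N M} {j : Fin M}
    (h : ∀ m : Fin M →₀ ℕ, m j • MvPowerSeries.coeff m F = ∑ k ∈ range (m j + 1), if Odd k then
      (2 : ℂ) • (∑ i, xShift r i ^ k) (MvPowerSeries.coeff (m - Finsupp.single j k) F) else 0) :
    linOp r N M j F = 0 := by
  refine MvPowerSeries.ext fun m => ?_
  rw [linOp, LinearMap.sub_apply, LinearMap.smul_apply, LinearMap.sum_apply, map_sub, map_nsmul,
    map_sum, coeff_eulerY, h, map_zero, sub_eq_zero]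
  have hi : ∀ i, MvPowerSeries.coeff m
      ((shiftOp r i j * geom (shiftOp r i j ^ 2) : Module.End ℂ (Mixed N M)) F) =
      ∑ k ∈ range (m j + 1), if Odd k then
        (xShift r i ^ k) (MvPowerSeries.coeff (m - Finsupp.single j k) F) else 0 := by
    intro i
    have hA := raises_shiftOp r i j
    -- Here A(A²)ˡ = A²ˡ⁺¹ runs through the odd powers; those with 2l + 1 ≤ m j satisfy l <
    -- `m.degree`, so this many terms suffice.
    rw [Module.End.mul_apply, coeff_mul_geom hA.sq hA F (n := m.degree) (by omega)]
    have hk : ∀ l, MvPowerSeries.coeff m (shiftOp r i j (((shiftOp r i j ^ 2) ^ l) F)) =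
        if 2 * l + 1 ≤ m j then (xShift r i ^ (2 * l + 1))
          (MvPowerSeries.coeff (m - Finsupp.single j (2 * l + 1)) F) else 0 := fun l => by
      rw [← pow_mul, ← Module.End.mul_apply, ← pow_succ', coeff_shiftOp_pow]
    simp only [hk]
    rw [← sum_filter, ← sum_filter]
    refine sum_bij (fun l _ => 2 * l + 1) ?_ ?_ ?_ ?_
    · intro l hl
      rw [mem_filter] at hl ⊢
      exact ⟨mem_range.2 (by omega), by simp⟩
    · intro l _ l' _ e
      omega
    · intro k hk
      rw [mem_filter, mem_range] at hk
      obtain ⟨hk1, l, rfl⟩ := hk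
      have := Finsupp.le_degree j m
      exact ⟨l, mem_filter.2 ⟨mem_range.2 (by omega), by omega⟩, rfl⟩
    · intro l _
      rfl
  simp only [hi]
  rw [sum_comm, smul_sum]
  refine sum_congr rfl fun k _ => ?_
  split_ifs
  · rw [LinearMap.sum_apply, ofNat_smul_eq_nsmul]
  · simp

/-! ### Parity -/

/-- The parity operator. -/
def parity : Module.End ℂ Fock :=
  Finsupp.linearCombination ℂ fun S => Finsupp.single S ((-1 : ℂ) ^ #S)

lemma parity_single (S : Finset ℕ) (c : ℂ) :
    parity (Finsupp.single S c) = Finsupp.single S (c * (-1) ^ #S) := by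
  rw [parity, Finsupp.linearCombination_single, Finsupp.smul_single, smul_eq_mul]

lemma parity_create (n : ℕ) (v : Fock) : parity (create n v) = -create n (parity v) := by
  suffices parity ∘ₗ create n = -(create n ∘ₗ parity) from LinearMap.congr_fun this v
  refine end_ext fun S => ?_
  rw [LinearMap.neg_apply, LinearMap.comp_apply, LinearMap.comp_apply, parity_single,
    create_single, create_single]
  split_ifs with h
  · simp
  · rw [parity_single, card_insert_of_notMem h, ← Finsupp.single_neg]
    congr 1
    ring

lemma parity_annih (n : ℕ) (v : Fock) : parity (annih n v) = -annih n (parity v) := by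
  suffices parity ∘ₗ annih n = -(annih n ∘ₗ parity) from LinearMap.congr_fun this v
  refine end_ext fun S => ?_
  rw [LinearMap.neg_apply, LinearMap.comp_apply, LinearMap.comp_apply, parity_single,
    annih_single, annih_single]
  split_ifs with h
  · have h1 : (-1 : ℂ) ^ #S = -(-1) ^ #(S.erase n) := by
      rw [← card_erase_add_one h, pow_succ]; ring
    rw [parity_single, h1, ← Finsupp.single_neg]
    congr 1
    ring
  · simp

lemma parity_phi (n : ℤ) (v : Fock) : parity (phi n v) = -phi n (parity v) := by
  rcases lt_trichotomy n 0 with h | rfl | h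
  · rw [phi_of_neg h, LinearMap.smul_apply, map_smul, parity_annih, LinearMap.smul_apply, smul_neg]
  · rw [phi_zero, LinearMap.add_apply, LinearMap.smul_apply, map_add, map_smul, parity_annih,
      parity_create, LinearMap.add_apply, LinearMap.smul_apply, smul_neg, neg_add]
  · rw [phi_of_pos h, parity_create]

lemma parity_bil (c : ℤ → ℂ) {s : ℤ} (hs : s ≠ 0) (v : Fock) :
    parity (bil c s v) = bil c s (parity v) := by
  obtain ⟨K, hK⟩ := exists_phi_phi_eq_zero hs v
  have h : ∀ k, parity (phi k (phi (s - k) v)) = phi k (phi (s - k) (parity v)) := fun k => by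
    rw [parity_phi, parity_phi, map_neg, neg_neg]
  rw [bil_eq_sum c hs hK, bil_eq_sum c hs (K := K) fun k hk => by rw [← h, hK k hk, map_zero],
    map_smul, map_sum]
  simp only [map_smul, h]

lemma parity_vacuum : parity vacuum = vacuum := by
  rw [vacuum, parity_single]; simp

lemma leftVacuum_parity (v : Fock) : leftVacuum (parity v) = leftVacuum v := by
  suffices leftVacuum ∘ₗ parity = leftVacuum from LinearMap.congr_fun this v
  refine end_ext fun S => ?_
  rw [LinearMap.comp_apply, parity_single, leftVacuum, Finsupp.lapply_apply, Finsupp.lapply_apply,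
    Finsupp.single_apply, Finsupp.single_apply]
  split_ifs with h
  · simp [h]
  · rfl

/-- For even v the vector φ₀v is odd, so its vacuum component vanishes. -/
lemma lam_of_parity {v : Fock} (hv : parity v = v) : lam v = leftVacuum v := by
  have h : leftVacuum (phi 0 v) = -leftVacuum (phi 0 v) := by
    conv_lhs => rw [← hv, ← neg_neg (phi 0 (parity v)), ← parity_phi, map_neg, leftVacuum_parity]
  rw [lam_apply, self_eq_neg.1 h, mul_zero, add_zero]

/-! ### The two exponentials -/

section Exponentials

variable {σ : Type} {n : ℕ}

/-- The coefficients of `exp (∑ t_m A_m)` at the odd power sums of some of the variables. -/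
def expCoeff (A : ℕ → Module.End ℂ Fock) (z : Fin n → σ) (α : σ →₀ ℕ) : Module.End ℂ Fock :=
  MvPowerSeries.coeff α (expOf (timesSumOf (powerTimes fun j => MvPowerSeries.X (z j)) A))

lemma map_coeff_timesSumOf {V W : Type} [AddCommGroup V] [Module ℂ V] [AddCommGroup W] [Module ℂ W]
    (f : V →ₗ[ℂ] W) {A : ℕ → Module.End ℂ V} {C : ℕ → Module.End ℂ W}
    (h : ∀ m, Odd m → ∀ v, f (A m v) = C m (f v)) (z : Fin n → σ) (α : σ →₀ ℕ) (v : V) :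
    f (MvPowerSeries.coeff α (timesSumOf (powerTimes fun j => MvPowerSeries.X (z j)) A) v) =
      MvPowerSeries.coeff α (timesSumOf (powerTimes fun j => MvPowerSeries.X (z j)) C) (f v) := by
  rw [coeff_timesSumOf, coeff_timesSumOf]
  split_ifs with ho
  · rw [LinearMap.smul_apply, LinearMap.smul_apply, map_smul, h _ ho]
  · rw [LinearMap.zero_apply, LinearMap.zero_apply, map_zero]

lemma map_coeff_exp {V W : Type} [AddCommGroup V] [Module ℂ V] [AddCommGroup W] [Module ℂ W]
    (f : V →ₗ[ℂ] W) {A : ℕ → Module.End ℂ V} {C : ℕ → Module.End ℂ W}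
    (h : ∀ m, Odd m → ∀ v, f (A m v) = C m (f v)) (z : Fin n → σ) (α : σ →₀ ℕ) (v : V) :
    f (MvPowerSeries.coeff α (expOf (timesSumOf (powerTimes fun j => MvPowerSeries.X (z j)) A)) v) =
      MvPowerSeries.coeff α (expOf (timesSumOf (powerTimes fun j => MvPowerSeries.X (z j)) C))
        (f v) :=
  map_expOf f (map_coeff_timesSumOf f h z) α v

lemma neg_timesSumOf (z : Fin n → σ) (A : ℕ → Module.End ℂ Fock) :
    -timesSumOf (powerTimes fun j => MvPowerSeries.X (z j)) A =
      timesSumOf (powerTimes fun j => MvPowerSeries.X (z j)) (-A) := by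
  refine MvPowerSeries.ext fun α => ?_
  rw [map_neg, coeff_timesSumOf, coeff_timesSumOf]
  split_ifs
  · refine LinearMap.ext fun v => ?_
    rw [LinearMap.neg_apply, LinearMap.smul_apply, LinearMap.smul_apply, Pi.neg_apply,
      LinearMap.neg_apply, smul_neg]
  · refine LinearMap.ext fun v => ?_
    rw [LinearMap.neg_apply, LinearMap.zero_apply, neg_zero]

end Exponentials

/-! ### Coefficients of the tau function and the formulas in Δ(x). -/

lemma coeff_tauXY_eq (r : ℤ → ℂ) (α : Fin N ⊕ Fin M →₀ ℕ) :
    MvPowerSeries.coeff α (tauXY r N M) = leftVacuum ((MvPowerSeries.coeff α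
      (expOf (timesSumOf (powerTimes fun i : Fin N => MvPowerSeries.X (Sum.inl i)) fun m => H m) *
        expOf (-timesSumOf (powerTimes fun j : Fin M => MvPowerSeries.X (Sum.inr j)) (B r))) :
          Module.End ℂ Fock) vacuum) := rfl

/-- One exponential contains only x and the other only y, so a single term of the convolution
survives. -/
lemma coeff_tauXY (r : ℤ → ℂ) (a : Fin N →₀ ℕ) (m : Fin M →₀ ℕ) :
    MvPowerSeries.coeff (Finsupp.sumElim a m) (tauXY r N M) =
      leftVacuum (expCoeff (fun m => H m) Sum.inl (Finsupp.sumElim a (0 : Fin M →₀ ℕ))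
        (expCoeff (-B r) Sum.inr (Finsupp.sumElim (0 : Fin N →₀ ℕ) m) vacuum)) := by
  classical
  rw [coeff_tauXY_eq, MvPowerSeries.coeff_mul, neg_timesSumOf, sum_eq_single
    (Finsupp.sumElim a (0 : Fin M →₀ ℕ), Finsupp.sumElim (0 : Fin N →₀ ℕ) m)]
  · rfl
  · rintro ⟨β, γ⟩ hβ hne
    rw [HasAntidiagonal.mem_antidiagonal] at hβ
    dsimp only at hβ ⊢
    by_cases h1 : ∃ j, β (Sum.inr j) ≠ 0
    · obtain ⟨j, hj⟩ := h1
      rw [coeff_expOf_eq_zero (s := Sum.inr j) (fun α hα => coeff_timesSumOf_eq_zero _ (by simp) hα)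
        hj, zero_mul]
    by_cases h2 : ∃ i, γ (Sum.inl i) ≠ 0
    · obtain ⟨i, hi⟩ := h2
      rw [coeff_expOf_eq_zero (s := Sum.inl i) (fun α hα => coeff_timesSumOf_eq_zero _ (by simp) hα)
        hi, mul_zero]
    push Not at h1 h2
    refine absurd (Prod.ext ?_ ?_) hne
    · ext s
      have := DFunLike.congr_fun hβ s
      rcases s with i | j
      · simpa [h2 i] using this
      · simpa using h1 j
    · ext s
      have := DFunLike.congr_fun hβ s
      rcases s with i | j
      · simpa using h2 i
      · simpa [h1 j] using this
  · intro h
    refine absurd (HasAntidiagonal.mem_antidiagonal.2 ?_) h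
    ext s
    rcases s with i | j <;> simp

/-- The vector `exp (-∑ t*_m B_m) |0⟩`. -/
def rightVec (r : ℤ → ℂ) (N : ℕ) {M : ℕ} (m : Fin M →₀ ℕ) : Fock :=
  expCoeff (-B r) Sum.inr (Finsupp.sumElim (0 : Fin N →₀ ℕ) m) vacuum

lemma coeff_expand_tauXY (r : ℤ → ℂ) (m : Fin M →₀ ℕ) :
    MvPowerSeries.coeff m (expand (tauXY r N M)) = vertGen N (rightVec r N m) := by
  ext e
  change (if ∀ i, 0 ≤ expo e i then MvPowerSeries.coeff (Finsupp.sumElim _ m) (tauXY r N M)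
    else 0) = lam (vertWord (List.finRange N) (expo e) (rightVec r N m))
  split_ifs with h
  · rw [coeff_tauXY, ← rightVec]
    have hw : ∀ (l : List (Fin N)) (α : Fin N ⊕ Fin M →₀ ℕ) (v : Fock),
        (∀ i, α (Sum.inl i) = (expo e i).toNat) →
        vertProd Sum.inl l α v = vertWord l (expo e) v := by
      intro l α v hα
      induction l with
      | nil => rfl
      | cons i l ih =>
        rw [vertProd_cons, vertWord, Module.End.mul_apply, ih, hα, vertInt, if_pos (h i)]
    set α := Finsupp.sumElim (Finsupp.equivFunOnFinite.symm fun i => (expo e i).toNat)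
      (0 : Fin M →₀ ℕ) with hα
    have hv : expCoeff (fun m => H m) Sum.inl α (rightVec r N m) =
        vertWord (List.finRange N) (expo e) (rightVec r N m) := by
      rw [expCoeff, coeff_exp_H Sum.inl_injective, hw]
      · intro i; simp [hα]
      · rintro (i | j) hs
        · exact absurd ⟨i, rfl⟩ hs
        · simp [hα]
    rw [← hv, lam_of_parity]
    rw [expCoeff, map_coeff_exp parity (C := fun m => H m), rightVec, expCoeff,
      map_coeff_exp parity (C := -B r), parity_vacuum]
    · intro m hm v
      have := hm.pos
      rw [Pi.neg_apply, LinearMap.neg_apply, map_neg, B_eq_bil, parity_bil _ (by omega)]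
      rfl
    · intro m hm v
      have := hm.pos
      rw [H_eq_bil, parity_bil _ (by omega)]
  · push Not at h
    obtain ⟨i, hi⟩ := h
    rw [vertWord_eq_zero (List.mem_finRange i) hi, map_zero]

/-- The sum of the `m`-th powers of the operators `x_i r(-D_{x_i})`. -/
def xShiftSum (r : ℤ → ℂ) (N m : ℕ) : Module.End ℂ (Laurent N) := ∑ i, xShift r i ^ m

lemma xShiftSum_commute (r : ℤ → ℂ) (m n : ℕ) :
    Commute (xShiftSum r N m) (xShiftSum r N n) :=
  Commute.sum_right _ _ _ fun j _ => Commute.sum_left _ _ _ fun i _ =>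
    (xShift_commute r i j).pow_pow m n

/-- The map `fermGen` intertwines -Bₘ with `xShiftSum`, hence also the exponentials, and it sends
the vacuum to Δ(x). -/
lemma coeff_DeltaX_mul {r : ℤ → ℂ} (hr : ∀ n, r n = r (1 - n)) (m : Fin M →₀ ℕ) :
    MvPowerSeries.coeff m (DeltaX N M * expand (tauXY r N M)) =
      MvPowerSeries.coeff (Finsupp.sumElim (0 : Fin N →₀ ℕ) m) (expOf (timesSumOf
        (powerTimes fun j : Fin M => MvPowerSeries.X (Sum.inr j)) (xShiftSum r N))) (Delta N) := by
  rw [DeltaX, MvPowerSeries.coeff_C_mul, coeff_expand_tauXY, Delta_mul_vertGen, rightVec, expCoeff,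
    map_coeff_exp (fermGen N) (C := xShiftSum r N), fermGen_vacuum]
  intro m hm v
  rw [Pi.neg_apply, LinearMap.neg_apply, map_neg, fermGen_B hr hm, neg_neg]
  rfl

theorem linOp_DeltaX_mul {r : ℤ → ℂ} (hr : ∀ n, r n = r (1 - n)) (j : Fin M) :
    linOp r N M j (DeltaX N M * expand (tauXY r N M)) = 0 := by
  refine linOp_eq_zero fun m => ?_
  have h := LinearMap.congr_fun (coeff_expOf_timesSumOf (z := (Sum.inr : Fin M → Fin N ⊕ Fin M))
    Sum.inr_injective (fun m n _ _ => xShiftSum_commute (N := N) r m n) j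
    (Finsupp.sumElim (0 : Fin N →₀ ℕ) m)) (Delta N)
  have e : ∀ k, Finsupp.sumElim (0 : Fin N →₀ ℕ) m - Finsupp.single (Sum.inr j) k =
      Finsupp.sumElim (0 : Fin N →₀ ℕ) (m - Finsupp.single j k) := by
    classical
    intro k
    ext s
    rcases s with i | i <;> simp [Finsupp.single_apply]
  rw [LinearMap.sum_apply] at h
  simp only [e, Finsupp.sumElim_inr] at h
  rw [coeff_DeltaX_mul hr]
  refine h.trans (sum_congr rfl fun k _ => ?_)
  rw [coeff_DeltaX_mul hr]
  split_ifs <;> rfl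

theorem DeltaX_mul_eq_prodOp {r : ℤ → ℂ} (hr : ∀ n, r n = r (1 - n)) :
    DeltaX N M * expand (tauXY r N M) = prodOp r N M (DeltaX N M) := by
  rw [← sub_eq_zero]
  refine eq_zero_of_linOp (r := r) (fun j => ?_) ?_
  · rw [map_sub, linOp_DeltaX_mul hr, linOp_prodOp, sub_zero]
  · have e : Finsupp.sumElim (0 : Fin N →₀ ℕ) (0 : Fin M →₀ ℕ) = 0 := by
      ext s
      rcases s with i | i <;> rfl
    rw [map_sub, coeff_zero_prodOp, coeff_DeltaX_mul hr, e, coeff_zero_expOf, DeltaX,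
      MvPowerSeries.coeff_zero_C, Module.End.one_apply, sub_self]

/-! ### The symmetric bilinear form -/

/-- The square of the norm of a basis vector. -/
def normSq (S : Finset ℕ) : ℂ := if 0 ∈ S then 1 / 2 else 1

lemma normSq_ne_zero (S : Finset ℕ) : normSq S ≠ 0 := by
  unfold normSq; split_ifs <;> norm_num

/-- The symmetric bilinear form for which `(-1)^n φ_{-n}` is the adjoint of `φ_n`. -/
def form : Fock →ₗ[ℂ] Fock →ₗ[ℂ] ℂ :=
  Finsupp.linearCombination ℂ fun S => normSq S • Finsupp.lapply S

lemma form_single (S : Finset ℕ) (v : Fock) : form (Finsupp.single S 1) v = normSq S * v S := by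
  rw [form, Finsupp.linearCombination_single, one_smul, LinearMap.smul_apply,
    Finsupp.lapply_apply, smul_eq_mul]

lemma form_single_single (S T : Finset ℕ) (c : ℂ) :
    form (Finsupp.single S 1) (Finsupp.single T c) = if T = S then normSq S * c else 0 := by
  rw [form_single, Finsupp.single_apply]
  split_ifs <;> simp

lemma form_ext {f g : Fock →ₗ[ℂ] Fock →ₗ[ℂ] ℂ}
    (h : ∀ S T, f (Finsupp.single S 1) (Finsupp.single T 1) =
      g (Finsupp.single S 1) (Finsupp.single T 1)) (u v : Fock) : f u v = g u v := by
  have : f = g := end_ext fun S => end_ext fun T => h S T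
  rw [this]

lemma form_comm (u v : Fock) : form u v = form v u := by
  refine form_ext (f := form) (g := form.flip) (fun S T => ?_) u v
  rw [LinearMap.flip_apply, form_single_single, form_single_single]
  by_cases h : T = S
  · rw [if_pos h, if_pos h.symm, h]
  · rw [if_neg h, if_neg (Ne.symm h)]

lemma eq_of_form_eq {v w : Fock} (h : ∀ u, form u v = form u w) : v = w := by
  ext S
  have := h (Finsupp.single S 1)
  rw [form_single, form_single] at this
  exact mul_left_cancel₀ (normSq_ne_zero S) this

lemma leftVacuum_eq_form (v : Fock) : leftVacuum v = form vacuum v := by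
  rw [vacuum, form_single, normSq, if_neg (notMem_empty 0), one_mul]; rfl

/-- The factor 1/2 at n = 0 comes from `normSq`; it matches the ½ in `phi_zero` and makes φ₀
self-adjoint. -/
lemma form_create (n : ℕ) (u v : Fock) :
    form (create n u) v = (if n = 0 then 1 / 2 else 1) * form u (annih n v) := by
  refine form_ext (f := form ∘ₗ create n)
    (g := (if n = 0 then 1 / 2 else 1 : ℂ) • form.compl₂ (annih n)) (fun S T => ?_) u v
  rw [LinearMap.comp_apply, LinearMap.smul_apply, LinearMap.smul_apply, LinearMap.compl₂_apply,
    create_single, annih_single, smul_eq_mul, one_mul, one_mul]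
  by_cases hS : n ∈ S
  · rw [if_pos hS, map_zero, LinearMap.zero_apply]
    by_cases hT : n ∈ T
    · rw [if_pos hT, form_single_single,
        if_neg (show ¬ T.erase n = S from fun h => notMem_erase n T (h.symm ▸ hS)), mul_zero]
    · rw [if_neg hT, map_zero, mul_zero]
  · rw [if_neg hS, form_comm, form_single_single]
    by_cases hT : n ∈ T
    · rw [if_pos hT, form_single_single]
      by_cases h : insert n S = T
      · have h' : T.erase n = S := by rw [← h, erase_insert hS]
        rw [if_pos h, if_pos h', ← h, sgn_insert hS, sg_self, mul_one, ← mul_assoc]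
        congr 1
        rw [normSq, normSq]
        by_cases hn : n = 0
        · subst hn
          simp [hS]
        · simp [hn, Ne.symm hn]
      · have h' : ¬ T.erase n = S := fun h' => h (by rw [← h', insert_erase hT])
        rw [if_neg h, if_neg h', mul_zero]
    · rw [if_neg hT, if_neg (show ¬ insert n S = T from fun h => hT (h ▸ mem_insert_self n S)),
        map_zero, mul_zero]

lemma form_annih (n : ℕ) (u v : Fock) :
    (if n = 0 then 1 / 2 else 1) * form (annih n u) v = form u (create n v) := by
  rw [form_comm, ← form_create, form_comm]

lemma form_phi (n : ℤ) (u v : Fock) : form (phi n u) v = (-1) ^ n * form u (phi (-n) v) := by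
  rcases lt_trichotomy n 0 with h | rfl | h
  · have := form_annih n.natAbs u v
    rw [if_neg (by omega), one_mul] at this
    rw [phi_of_neg h, phi_of_pos (by omega), LinearMap.smul_apply, map_smul, LinearMap.smul_apply,
      smul_eq_mul, this, Int.natAbs_neg]
  · have h1 := form_annih 0 u v
    have h2 := form_create 0 u v
    rw [if_pos rfl] at h1 h2
    rw [neg_zero, zpow_zero, one_mul, phi_zero, LinearMap.add_apply, LinearMap.add_apply, map_add,
      map_add, LinearMap.add_apply, LinearMap.smul_apply, LinearMap.smul_apply, map_smul, map_smul,
      LinearMap.smul_apply, smul_eq_mul, smul_eq_mul, h1, h2, add_comm]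
  · have := form_create n.natAbs u v
    rw [if_neg (by omega), one_mul] at this
    rw [phi_of_pos h, phi_of_neg (m := -n) (by omega), LinearMap.smul_apply, map_smul, smul_eq_mul,
      this, Int.natAbs_neg, neg_one_zpow_neg, ← mul_assoc, neg_one_zpow_mul_self, one_mul]

lemma form_H {m : ℕ} (hm : Odd m) (u v : Fock) : form (H m u) v = form u (H (-m) v) := by
  have h0 := hm.pos
  have hs : -(m : ℤ) ≠ 0 := by omega
  have hs' : - -(m : ℤ) ≠ 0 := by omega
  obtain ⟨K₁, h₁⟩ := exists_phi_phi_eq_zero hs u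
  obtain ⟨K₂, h₂⟩ := exists_phi_phi_eq_zero hs' v
  -- The adjoint of φₖφ₋ₘ₋ₖ is up to sign φₖ₊ₘφ₋ₖ, so the index set for H₋ₘ is the one for Hₘ
  -- shifted by m.
  rw [H_eq_bil, H_eq_bil, bil_eq_sum _ hs (K := K₁ ∪ K₂.image (· - (m : ℤ))),
    bil_eq_sum _ hs' (K := (K₁ ∪ K₂.image (· - (m : ℤ))).image (· + (m : ℤ))),
    sum_image (by intro a _ b _ h; simpa using h), map_smul, map_smul, LinearMap.smul_apply,
    map_sum, map_sum, LinearMap.sum_apply]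
  · congr 1
    refine sum_congr rfl fun k _ => ?_
    rw [map_smul, map_smul, LinearMap.smul_apply, form_phi, form_phi, neg_neg,
      show -(-(m : ℤ) - k) = k + m by ring, show (m : ℤ) - (k + m) = -k by ring, smul_eq_mul,
      smul_eq_mul, ← mul_assoc, ← mul_assoc]
    congr 1
    rw [show k + (m : ℤ) + 1 = k + 1 + m by ring, neg_one_zpow_add_odd _ hm,
      show -(m : ℤ) - k = -(k + m) by ring, neg_one_zpow_neg, neg_one_zpow_add_odd _ hm]
    linear_combination (-(-1) ^ (k + 1)) * neg_one_zpow_mul_self k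
  · intro k hk
    refine h₂ k fun h => hk ?_
    exact mem_image.2 ⟨k - m, mem_union_right _ (mem_image_of_mem _ h), by ring⟩
  · intro k hk
    exact h₁ k fun h => hk (mem_union_left _ h)

/-! ### The diagonal operator relating `B_m` for different `r` -/

/-- The product `r(1) r(2) ⋯ r(n)`. -/
def rprod (r : ℤ → ℂ) (n : ℕ) : ℂ := ∏ l ∈ range n, r (l + 1)

/-- The operator multiplying a basis vector by the product of `r(1) ⋯ r(s)` over its indices. -/
def diag (r : ℤ → ℂ) : Module.End ℂ Fock :=
  Finsupp.linearCombination ℂ fun S => Finsupp.single S (∏ s ∈ S, rprod r s)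

lemma diag_single (r : ℤ → ℂ) (S : Finset ℕ) (c : ℂ) :
    diag r (Finsupp.single S c) = Finsupp.single S (c * ∏ s ∈ S, rprod r s) := by
  rw [diag, Finsupp.linearCombination_single, Finsupp.smul_single, smul_eq_mul]

lemma diag_vacuum (r : ℤ → ℂ) : diag r vacuum = vacuum := by
  rw [vacuum, diag_single]; simp

lemma form_diag (r : ℤ → ℂ) (u v : Fock) : form (diag r u) v = form u (diag r v) := by
  refine form_ext (f := form ∘ₗ diag r) (g := form.compl₂ (diag r)) (fun S T => ?_) u v
  rw [LinearMap.comp_apply, LinearMap.compl₂_apply, diag_single, diag_single, form_comm,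
    form_single_single, form_single_single]
  by_cases h : T = S
  · rw [if_pos h, if_pos h.symm, h]
  · rw [if_neg h, if_neg (Ne.symm h)]

lemma diag_create (r : ℤ → ℂ) (n : ℕ) (v : Fock) :
    diag r (create n v) = rprod r n • create n (diag r v) := by
  suffices diag r ∘ₗ create n = rprod r n • (create n ∘ₗ diag r) from LinearMap.congr_fun this v
  refine end_ext fun S => ?_
  rw [LinearMap.smul_apply, LinearMap.comp_apply, LinearMap.comp_apply, diag_single,
    create_single, create_single]
  split_ifs with h
  · simp
  · rw [diag_single, prod_insert h, Finsupp.smul_single, smul_eq_mul]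
    congr 1
    ring

/-- Here r may have zeros, so the diagonal operator need not be invertible. It stands on the right
for annihilation and on the left for creation, which avoids division. -/
lemma annih_diag (r : ℤ → ℂ) (n : ℕ) (v : Fock) :
    annih n (diag r v) = rprod r n • diag r (annih n v) := by
  suffices annih n ∘ₗ diag r = rprod r n • (diag r ∘ₗ annih n) from LinearMap.congr_fun this v
  refine end_ext fun S => ?_
  rw [LinearMap.smul_apply, LinearMap.comp_apply, LinearMap.comp_apply, diag_single,
    annih_single, annih_single]
  split_ifs with h
  · rw [diag_single, Finsupp.smul_single, smul_eq_mul, ← mul_prod_erase S _ h]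
    congr 1
    ring
  · simp

lemma rprod_zero (r : ℤ → ℂ) : rprod r 0 = 1 := rfl

lemma diag_phi {r : ℤ → ℂ} {n : ℤ} (hn : 0 ≤ n) (v : Fock) :
    diag r (phi n v) = rprod r n.natAbs • phi n (diag r v) := by
  rcases hn.eq_or_lt with rfl | h
  · have := annih_diag r 0 v
    rw [rprod_zero, one_smul] at this
    rw [phi_zero, LinearMap.add_apply, LinearMap.add_apply, map_add, diag_create,
      LinearMap.smul_apply, LinearMap.smul_apply, map_smul, this, Int.natAbs_zero, rprod_zero,
      one_smul, one_smul]
  · rw [phi_of_pos h, diag_create]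

lemma phi_diag {r : ℤ → ℂ} {n : ℤ} (hn : n ≤ 0) (v : Fock) :
    phi n (diag r v) = rprod r n.natAbs • diag r (phi n v) := by
  rcases hn.eq_or_lt with rfl | h
  · rw [diag_phi le_rfl, Int.natAbs_zero, rprod_zero, one_smul, one_smul]
  · rw [phi_of_neg h, LinearMap.smul_apply, LinearMap.smul_apply, map_smul, annih_diag, smul_comm]

lemma prod_range_sub (r : ℤ → ℂ) (m k : ℕ) :
    ∏ l ∈ range m, r ((m + k : ℕ) - l) = ∏ l ∈ range m, r ((k + l : ℕ) + 1) := by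
  rw [← prod_range_reflect]
  refine prod_congr rfl fun l hl => ?_
  rw [mem_range] at hl
  congr 1
  omega

lemma prod_range_mul_rprod (r : ℤ → ℂ) (m k : ℕ) :
    (∏ l ∈ range m, r ((m + k : ℕ) - l)) * rprod r k = rprod r (m + k) := by
  rw [prod_range_sub, rprod, rprod, add_comm m k, prod_range_add, mul_comm]

lemma diag_phi_phi_of_lt {r : ℤ → ℂ} {m : ℕ} {n : ℤ} (hn : m ≤ n) (v : Fock) :
    diag r (phi n (phi (m - n) v)) =
      (∏ l ∈ range m, r (n - l)) • phi n (phi (m - n) (diag r v)) := by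
  obtain ⟨k, rfl⟩ : ∃ k : ℕ, n = (m + k : ℕ) := ⟨(n - m).toNat, by omega⟩
  rw [diag_phi (n := (m + k : ℕ)) (by omega), phi_diag (n := m - (m + k : ℕ)) (by omega), map_smul,
    smul_smul, show ((m : ℤ) - (m + k : ℕ)).natAbs = k by omega, prod_range_mul_rprod,
    Int.natAbs_natCast]

/-- For n ≥ m the factor is r(1)⋯r(n) with r(1)⋯r(n-m) removed, and n < 0 reduces to this by
swapping the fermions. For 0 ≤ n < m neither index is negative, and the arguments of r that are ≤ 0
are reflected by r(n) = r(1 - n). -/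
lemma diag_phi_phi {r : ℤ → ℂ} (hr : ∀ n, r n = r (1 - n)) {m : ℕ} (hm : 0 < m) (n : ℤ)
    (v : Fock) : diag r (phi n (phi (m - n) v)) =
      (∏ l ∈ range m, r (n - l)) • phi n (phi (m - n) (diag r v)) := by
  rcases le_or_gt (m : ℤ) n with h | h
  · exact diag_phi_phi_of_lt h v
  rcases lt_or_ge n 0 with h' | h'
  · have key := diag_phi_phi_of_lt (r := r) (m := m) (n := m - n) (by omega) v
    have hm' : (m : ℤ) ≠ 0 := by omega
    rw [sub_sub_cancel] at key
    rw [phi_phi_swap hm', phi_phi_swap hm', map_neg, key, smul_neg]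
    congr 2
    rw [← prod_range_reflect]
    refine prod_congr rfl fun l hl => ?_
    rw [mem_range] at hl
    rw [hr]
    congr 1
    omega
  · obtain ⟨k, rfl⟩ := Int.eq_ofNat_of_zero_le h'
    obtain ⟨j, rfl⟩ : ∃ j, m = k + j := ⟨m - k, by omega⟩
    rw [diag_phi (n := (k : ℤ)) (by omega), diag_phi (n := (k + j : ℕ) - (k : ℤ)) (by omega), map_smul, smul_smul,
      show (((k + j : ℕ) : ℤ) - (k : ℕ)).natAbs = j by omega, Int.natAbs_natCast, prod_range_add]
    congr 2
    · have := prod_range_sub r k 0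
      simp only [add_zero, zero_add] at this
      rw [this]
      rfl
    · refine prod_congr rfl fun l _ => ?_
      rw [hr]
      congr 1
      push_cast
      ring

lemma diag_H {r : ℤ → ℂ} (hr : ∀ n, r n = r (1 - n)) {m : ℕ} (hm : Odd m) (v : Fock) :
    diag r (H (-m) v) = -B r m (diag r v) := by
  have h0 := hm.pos
  have hs : (m : ℤ) ≠ 0 := by omega
  obtain ⟨K₁, h₁⟩ := exists_phi_phi_eq_zero hs v
  obtain ⟨K₂, h₂⟩ := exists_phi_phi_eq_zero hs (diag r v)
  rw [H_eq_bil, neg_neg, B_eq_bil,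
    bil_eq_sum _ hs (K := K₁ ∪ K₂) fun k hk => h₁ k fun h => hk (mem_union_left _ h),
    bil_eq_sum _ hs (K := K₁ ∪ K₂) fun k hk => h₂ k fun h => hk (mem_union_right _ h),
    map_smul, map_sum, ← smul_neg, ← sum_neg_distrib]
  congr 1
  refine sum_congr rfl fun k _ => ?_
  rw [map_smul, diag_phi_phi hr h0, smul_smul, ← neg_smul, zpow_add_one₀ (by norm_num)]
  congr 1
  ring

/-! ### Symmetry of the tau function -/

/-- The vector `exp (∑ t_m H_{-m}) |0⟩`. -/
def heisVec {σ : Type} {n : ℕ} (z : Fin n → σ) (α : σ →₀ ℕ) : Fock :=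
  expCoeff (fun m => H (-m)) z α vacuum

lemma form_expCoeff {σ : Type} {n : ℕ} (z : Fin n → σ) (α : σ →₀ ℕ) (u v : Fock) :
    form (expCoeff (fun m => H m) z α u) v = form u (expCoeff (fun m => H (-m)) z α v) := by
  refine expOf_adjoint form (fun β u v => ?_) α u v
  rw [coeff_timesSumOf, coeff_timesSumOf]
  split_ifs with ho
  · rw [LinearMap.smul_apply, LinearMap.smul_apply, map_smul, map_smul, LinearMap.smul_apply,
      form_H ho]
  · simp

/-- By nondegeneracy of the form it suffices to compare the adjoint exponentials of the Hₘ, whose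
coefficients depend only on the exponents by `coeff_exp_H`. -/
lemma heisVec_congr {σ τ : Type} {n : ℕ} {z : Fin n → σ} {z' : Fin n → τ}
    (hz : Function.Injective z) (hz' : Function.Injective z') {α : σ →₀ ℕ} {β : τ →₀ ℕ}
    (hα : ∀ s, s ∉ Set.range z → α s = 0) (hβ : ∀ s, s ∉ Set.range z' → β s = 0)
    (h : ∀ j, α (z j) = β (z' j)) : heisVec z α = heisVec z' β := by
  refine eq_of_form_eq fun u => ?_
  rw [heisVec, heisVec, ← form_expCoeff, ← form_expCoeff, expCoeff, expCoeff, coeff_exp_H hz α hα,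
    coeff_exp_H hz' β hβ, vertProd, vertProd]
  simp only [h]

/-- Both vacuum exponentials are expressed through H₋ₘ, the one in y by `diag_H`. The symmetry in x
and y becomes that of the form and of `diag`. -/
lemma coeff_tauXY_eq_form {r : ℤ → ℂ} (hr : ∀ n, r n = r (1 - n)) (a : Fin N →₀ ℕ)
    (m : Fin M →₀ ℕ) : MvPowerSeries.coeff (Finsupp.sumElim a m) (tauXY r N M) =
      form (heisVec Sum.inl (Finsupp.sumElim a (0 : Fin M →₀ ℕ)))
        (diag r (heisVec Sum.inr (Finsupp.sumElim (0 : Fin N →₀ ℕ) m))) := by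
  have h : expCoeff (-B r) Sum.inr (Finsupp.sumElim (0 : Fin N →₀ ℕ) m) vacuum =
      diag r (heisVec Sum.inr (Finsupp.sumElim (0 : Fin N →₀ ℕ) m)) := by
    rw [heisVec, expCoeff, expCoeff, map_coeff_exp (diag r) (C := -B r), diag_vacuum]
    intro k hk v
    rw [diag_H hr hk]
    rfl
  rw [coeff_tauXY, h, leftVacuum_eq_form, form_comm, form_expCoeff, form_comm]
  rfl

theorem rename_tauXY {r : ℤ → ℂ} (hr : ∀ n, r n = r (1 - n)) :
    MvPowerSeries.renameEquiv ℂ (Equiv.sumComm (Fin N) (Fin M)) (tauXY r N M) = tauXY r M N := by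
  refine MvPowerSeries.ext fun α => ?_
  obtain ⟨m, a, rfl⟩ : ∃ (m : Fin M →₀ ℕ) (a : Fin N →₀ ℕ), α = Finsupp.sumElim m a :=
    ⟨α.comapDomain Sum.inl Sum.inl_injective.injOn, α.comapDomain Sum.inr Sum.inr_injective.injOn,
      by ext s; rcases s with i | i <;> simp⟩
  have e : Finsupp.sumElim m a = Finsupp.embDomain (Equiv.sumComm (Fin N) (Fin M)).toEmbedding
      (Finsupp.sumElim a m) := by
    rw [Finsupp.embDomain_eq_mapDomain]
    exact (Finsupp.mapDomain_swap_sumElim a m).symm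
  have hc : MvPowerSeries.coeff (Finsupp.sumElim m a)
      (MvPowerSeries.renameEquiv ℂ (Equiv.sumComm (Fin N) (Fin M)) (tauXY r N M)) =
      MvPowerSeries.coeff (Finsupp.sumElim a m) (tauXY r N M) := by
    rw [e]
    exact MvPowerSeries.coeff_embDomain_rename _ _ _
  rw [hc, coeff_tauXY_eq_form hr, coeff_tauXY_eq_form hr, ← form_diag, form_comm]
  have h1 : ∀ {K L : ℕ} (b : Fin K →₀ ℕ),
      heisVec Sum.inl (Finsupp.sumElim b (0 : Fin L →₀ ℕ)) =
        heisVec Sum.inr (Finsupp.sumElim (0 : Fin L →₀ ℕ) b) := by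
    intro K L b
    refine heisVec_congr Sum.inl_injective Sum.inr_injective ?_ ?_ fun j => rfl
    · rintro (i | j) hs
      · exact absurd ⟨i, rfl⟩ hs
      · rfl
    · rintro (i | j) hs
      · rfl
      · exact absurd ⟨j, rfl⟩ hs
  rw [h1, h1]

end BKP

end

theorem mainTheorem9 (N M : ℕ) (r : ℤ → ℂ) (hr : ∀ n : ℤ, r n = r (1 - n)) :
    -- `F` is `τ_r(t(x), t*(y))` expanded in `y` over Laurent series in `x`,
    -- `G` is the same function expanded in `x` over Laurent series in `y`
    let F : BKP.Mixed N M := BKP.expand (BKP.tauXY r N M)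
    let G : BKP.Mixed M N :=
      BKP.expand (MvPowerSeries.renameEquiv ℂ (Equiv.sumComm (Fin N) (Fin M)) (BKP.tauXY r N M))
    BKP.DeltaX N M * F = BKP.prodOp r N M (BKP.DeltaX N M) ∧
    BKP.DeltaX M N * G = BKP.prodOp r M N (BKP.DeltaX M N) ∧
    (∀ j : Fin M, BKP.linOp r N M j (BKP.DeltaX N M * F) = 0) ∧
    (∀ i : Fin N, BKP.linOp r M N i (BKP.DeltaX M N * G) = 0) := by
  intro F G
  -- Exchanging x and y gives the tau function with N and M exchanged, so the statements about G are
  -- those about F.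
  have hG : G = BKP.expand (BKP.tauXY r M N) := congrArg BKP.expand (BKP.rename_tauXY hr)
  rw [hG]
  exact ⟨BKP.DeltaX_mul_eq_prodOp hr, BKP.DeltaX_mul_eq_prodOp hr, BKP.linOp_DeltaX_mul hr,
    BKP.linOp_DeltaX_mul hr⟩
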